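/- Let $P$ (processes) and $\Sigma$ (labels) be nonempty finite sets. A message sequence chart (MSC) over $P$ and $\Sigma$ is $M=(E,\to,\triangleleft,\mathit{loc},\lambda)$ with $E$ a nonempty finite set of events, $\mathit{loc}:E\to P$, $\lambda:E\to\Sigma$, and $\to,\triangleleft\subseteq E\times E$ such that, writing $E_p=\mathit{loc}^{-1}(p)$: $\to\subseteq\bigcup_p E_p\times E_p$, and on each $E_p$ the relation $\to$ is the direct-successor relation of a total order; $e\triangleleft f$ implies $\mathit{loc}(e)\ne\mathit{loc}(f)$; each event belongs to at most one $\triangleleft$-edge; if $e\triangleleft f$, $e'\triangleleft f'$ with $e,e'\in E_p$ and $f,f'\in E_q$, then $e\le_{\mathrm{proc}}e'$ iff $f\le_{\mathrm{proc}}f'$, where ${\le_{\mathrm{proc}}}={\to^*}$ and ${<_{\mathrm{proc}}}={\to^+}$; and ${\to}\cup{\triangleleft}$ is acyclic. Event formulas $\varphi$ and path formulas $\pi$ of the logic $\mathrm{PDL}_{\mathsf{sf}}[\mathsf{Loop}]$ are given by $$\varphi::=p\mid a\mid\varphi\lor\varphi\mid\lnot\varphi\mid\langle\pi\rangle\varphi\mid\mathsf{Loop}(\pi),$$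 $$\pi::={\to}\mid{\leftarrow}\mid{\triangleleft_{p,q}}\mid{\triangleleft_{p,q}^{-1}}\mid{\xrightarrow{\varphi}}\mid{\xleftarrow{\varphi}}\mid\mathsf{jump}_{p,r}\mid\{\varphi\}?\mid\pi\cdot\pi,$$ with $p,q,r\in P$, $q\neq p$, $a\in\Sigma$. An event formula is evaluated at an event of $M$ and a path formula denotes a relation $[\![\pi]\!]\subseteq E\times E$: $M,e\models p$ iff $\mathit{loc}(e)=p$; $M,e\models a$ iff $\lambda(e)=a$; the Boolean connectives are as usual; $M,e\models\langle\pi\rangle\varphi$ iff $M,f\models\varphi$ for some $f$ with $(e,f)\in[\![\pi]\!]$; $M,e\models\mathsf{Loop}(\pi)$ iff $(e,e)\in[\![\pi]\!]$. Moreover $\to$ denotes $\to$ and $\leftarrow$ its converse; $\triangleleft_{p,q}$ denotes ${\triangleleft}\cap(E_p\times E_q)$ and $\triangleleft_{p,q}^{-1}$ its converse; $\xrightarrow{\varphi}$ denotes the set of $(e,f)$ with $e<_{\mathrm{proc}}f$ such that $M,g\models\varphi$ for all $g$ with $e<_{\mathrm{proc}}g<_{\mathrm{proc}}f$; $\xleftarrow{\varphi}$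 denotes the set of $(e,f)$ with $f<_{\mathrm{proc}}e$ such that $M,g\models\varphi$ for all $g$ with $f<_{\mathrm{proc}}g<_{\mathrm{proc}}e$; $\mathsf{jump}_{p,r}$ denotes $E_p\times E_r$; $\{\varphi\}?$ denotes $\{(e,e)\mid M,e\models\varphi\}$; and $\pi_1\cdot\pi_2$ denotes relational composition ($\pi_1$ first). A communicating finite-state machine (CFM) over $P$ and $\Sigma$ consists of a finite message set $\mathit{Msg}$; for each $p\in P$ a finite state set $S_p$, an initial state $\iota_p\in S_p$ and transitions $\Delta_p\subseteq S_p\times\mathrm{Act}_p\times S_p$, where the actions in $\mathrm{Act}_p$ are internal actions with a label $a\in\Sigma$, and send to $q$ / receive from $q$ actions with a label $a\in\Sigma$, a message $m\in\mathit{Msg}$ and a process $q\ne p$; and an acceptance set $\mathit{Acc}\subseteq\prod_pS_p$. A run on $M$ assigns to each $e\in E_p$ a transition in $\Delta_p$ with label $\lambda(e)$, such that $\to$-minimal events start in the initial state; $e\to f$ implies that the target state at $e$ is the source state at $f$; events on no $\triangleleft$-edge carry internal transitions; and for $e\triangleleft f$ the transition at $e$ is a send to $\mathit{loc}(f)$ and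 that at $f$ is a receive from $\mathit{loc}(e)$, with the same message. A run is accepting if the tuple of last states ($\iota_p$ if $E_p=\emptyset$) lies in $\mathit{Acc}$. The language $\mathbb L(\mathcal A)$ is the set of MSCs with an accepting run. A letter-to-letter MSC transducer from $\Sigma$ to $\Gamma$ is a CFM $\mathcal A$ over $P$ and $\Sigma\times\Gamma$; it accepts the relation $$[\![\mathcal A]\!]=\{((E,\to,\triangleleft,\mathit{loc},\lambda),(E,\to,\triangleleft,\mathit{loc},\gamma))\mid(E,\to,\triangleleft,\mathit{loc},\lambda\times\gamma)\in\mathbb L(\mathcal A)\}.$$ For an event formula $\varphi$ let $M_\varphi=(E,\to,\triangleleft,\mathit{loc},\gamma)$ be the MSC over $P$ and $\{0,1\}$ with $\gamma(e)=1$ if $M,e\models\varphi$ and $\gamma(e)=0$ otherwise. Theorem. For every $\mathrm{PDL}_{\mathsf{sf}}[\mathsf{Loop}]$ event formula $\varphi$ over $P$ and $\Sigma$ there is a letter-to-letter MSC transducer $\mathcal A_\varphi$ from $\Sigma$ to $\{0,1\}$ such that $$[\![\mathcal A_\varphi]\!]=\{(M,M_\varphi)\mid M\text{ an MSC over }P\text{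 and }\Sigma\}.$$ -/

import Mathlib

universe u v w

/-- A message sequence chart over the set of processes `P` and the set of labels `A`: a finite
nonempty set of events with process edges, message edges, locations and labels. -/
structure MSC (P : Type u) (A : Type v) where
  Event : Type
  finite_event : Finite Event
  nonempty_event : Nonempty Event
  /-- process edges `e → f` -/
  proc : Event → Event → Prop
  /-- message edges `e ◁ f` -/
  msg : Event → Event → Prop
  loc : Event → P
  lab : Event → A
  proc_loc : ∀ e f, proc e f → loc e = loc f
  /-- On every process, `→` is the direct-successor relation of some total order. -/
  proc_succ : ∀ p : P, ∃ _ : LinearOrder {e : Event // loc e = p},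
    ∀ e f : {e : Event // loc e = p}, proc e.1 f.1 ↔ e ⋖ f
  msg_loc : ∀ e f, msg e f → loc e ≠ loc f
  /-- Each event is part of at most one message edge. -/
  msg_unique : ∀ e f e' f', msg e f → msg e' f' →
    (e = e' ∨ e = f' ∨ f = e' ∨ f = f') → e = e' ∧ f = f'
  /-- Channels are FIFO. -/
  fifo : ∀ e f e' f', msg e f → msg e' f' → loc e = loc e' → loc f = loc f' →
    (Relation.ReflTransGen proc e e' ↔ Relation.ReflTransGen proc f f')
  acyclic : ∀ e, ¬ Relation.TransGen (fun x y => proc x y ∨ msg x y) e e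

namespace MSC

variable {P : Type u} {A : Type v} {B : Type w}

/-- `e ≤_proc f` -/
def procLE (M : MSC P A) : M.Event → M.Event → Prop := Relation.ReflTransGen M.proc

/-- `e <_proc f` -/
def procLT (M : MSC P A) : M.Event → M.Event → Prop := Relation.TransGen M.proc

/-- The set `E_p` of events located on process `p`. -/
abbrev On (M : MSC P A) (p : P) : Type := {e : M.Event // M.loc e = p}

/-- An event that is neither a send nor a receive event. -/
def IsInternal (M : MSC P A) (e : M.Event) : Prop := ∀ f, ¬ M.msg e f ∧ ¬ M.msg f e

/-- The MSC with the same events, edges and locations, and with new labels. -/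
abbrev relabel (M : MSC P A) (γ : M.Event → B) : MSC P B where
  Event := M.Event
  finite_event := M.finite_event
  nonempty_event := M.nonempty_event
  proc := M.proc
  msg := M.msg
  loc := M.loc
  lab := γ
  proc_loc := M.proc_loc
  proc_succ := M.proc_succ
  msg_loc := M.msg_loc
  msg_unique := M.msg_unique
  fifo := M.fifo
  acyclic := M.acyclic

end MSC

/-- The actions of process `p`, over the labels `A` and the messages `Msg`. -/
inductive CFMAction (P : Type u) (A : Type v) (Msg : Type) (p : P) : Type (max u v)
  | internal (a : A) : CFMAction P A Msg p
  /-- write message `m` to the channel `(p, q)` -/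
  | send (a : A) (m : Msg) (q : P) (h : q ≠ p) : CFMAction P A Msg p
  /-- read message `m` from the channel `(q, p)` -/
  | receive (a : A) (m : Msg) (q : P) (h : q ≠ p) : CFMAction P A Msg p

/-- The label in `A` of an action. -/
def CFMAction.label {P : Type u} {A : Type v} {Msg : Type} {p : P} : CFMAction P A Msg p → A
  | .internal a => a
  | .send a _ _ _ => a
  | .receive a _ _ _ => a

/-- A transition of process `p` with states in `S`. -/
structure CFMTransition (P : Type u) (A : Type v) (Msg : Type) (S : Type) (p : P) where
  source : S
  action : CFMAction P A Msg p
  target : S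

/-- A communicating finite-state machine over `P` and `A`. -/
structure CFM (P : Type u) (A : Type v) where
  Msg : Type
  finite_msg : Finite Msg
  State : P → Type
  finite_state : ∀ p, Finite (State p)
  init : ∀ p, State p
  trans : ∀ p, Set (CFMTransition P A Msg (State p) p)
  acc : Set (∀ p, State p)

namespace CFM

variable {P : Type u} {A : Type v}

/-- A run of a CFM on an MSC assigns to each event of `E_p` a transition of process `p`. -/
structure IsRun (C : CFM P A) (M : MSC P A)
    (ρ : ∀ p, M.On p → CFMTransition P A C.Msg (C.State p) p) : Prop where
  mem_trans : ∀ p (e : M.On p), ρ p e ∈ C.trans p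
  label_eq : ∀ p (e : M.On p), (ρ p e).action.label = M.lab e.1
  source_init : ∀ p (e : M.On p), (∀ f, ¬ M.proc f e.1) → (ρ p e).source = C.init p
  proc_edge : ∀ p (e f : M.On p), M.proc e.1 f.1 → (ρ p e).target = (ρ p f).source
  internal : ∀ p (e : M.On p), M.IsInternal e.1 → ∃ a, (ρ p e).action = .internal a
  msg_edge : ∀ p q (e : M.On p) (f : M.On q), M.msg e.1 f.1 →
    ∃ a b m hq hp, (ρ p e).action = .send a m q hq ∧ (ρ q f).action = .receive b m p hp

/-- `s` is the tuple of last states of `ρ`: the target state at the last event of each process,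
and the initial state for a process without events. -/
def IsLast (C : CFM P A) (M : MSC P A)
    (ρ : ∀ p, M.On p → CFMTransition P A C.Msg (C.State p) p) (s : ∀ p, C.State p) : Prop :=
  (∀ p (e : M.On p), (∀ f : M.On p, M.procLE f.1 e.1) → s p = (ρ p e).target) ∧
  (∀ p, IsEmpty (M.On p) → s p = C.init p)

/-- The language of a CFM: the MSCs on which it has an accepting run. -/
def language (C : CFM P A) : Set (MSC P A) :=
  {M | ∃ ρ, C.IsRun M ρ ∧ ∃ s, C.IsLast M ρ s ∧ s ∈ C.acc}

end CFM

/-- A letter-to-letter MSC transducer from `A` to `B` is a CFM over `P` and `A × B`. -/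
abbrev Transducer (P : Type u) (A : Type v) (B : Type w) := CFM P (A × B)

/-- The relation accepted by a transducer: all pairs `((E,→,◁,loc,λ), (E,→,◁,loc,γ))` such that
`(E,→,◁,loc,λ × γ)` is in the language of the CFM. -/
def Transducer.relation {P : Type u} {A : Type v} {B : Type w} (T : Transducer P A B) :
    Set (MSC P A × MSC P B) :=
  {x | ∃ N ∈ CFM.language T,
    x = (N.relabel fun e => (N.lab e).1, N.relabel fun e => (N.lab e).2)}

mutual

/-- Event formulas of star-free PDL with the loop modality. -/
inductive EventFormula (P : Type u) (A : Type v) : Type (max u v)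
  | atProc (p : P) : EventFormula P A
  | letter (a : A) : EventFormula P A
  | or (φ ψ : EventFormula P A) : EventFormula P A
  | not (φ : EventFormula P A) : EventFormula P A
  /-- `⟨π⟩ φ` -/
  | diamond (π : PathFormula P A) (φ : EventFormula P A) : EventFormula P A
  /-- `Loop(π)` -/
  | loop (π : PathFormula P A) : EventFormula P A

/-- Path formulas of star-free PDL with the loop modality (no union, intersection or
complement). -/
inductive PathFormula (P : Type u) (A : Type v) : Type (max u v)
  /-- `→` -/
  | next : PathFormula P A
  /-- `←` -/
  | prev : PathFormula P A
  /-- `◁_{p,q}` -/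
  | msg (p q : P) (h : q ≠ p) : PathFormula P A
  /-- `◁_{p,q}⁻¹` -/
  | msgInv (p q : P) (h : q ≠ p) : PathFormula P A
  /-- `→` with superscript `φ` (strict future on the same process, `φ` strictly in between) -/
  | until (φ : EventFormula P A) : PathFormula P A
  /-- `←` with superscript `φ` (strict past on the same process, `φ` strictly in between) -/
  | since (φ : EventFormula P A) : PathFormula P A
  | jump (p r : P) : PathFormula P A
  /-- `{φ}?` -/
  | test (φ : EventFormula P A) : PathFormula P A
  /-- concatenation `π₁ · π₂` -/
  | comp (π₁ π₂ : PathFormula P A) : PathFormula P A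

end

mutual

/-- `M, e ⊨ φ` -/
def EventFormula.Sat {P : Type u} {A : Type v} (M : MSC P A) :
    EventFormula P A → M.Event → Prop
  | .atProc p, e => M.loc e = p
  | .letter a, e => M.lab e = a
  | .or φ ψ, e => EventFormula.Sat M φ e ∨ EventFormula.Sat M ψ e
  | .not φ, e => ¬ EventFormula.Sat M φ e
  | .diamond π φ, e => ∃ f, PathFormula.Sat M π e f ∧ EventFormula.Sat M φ f
  | .loop π, e => PathFormula.Sat M π e e

/-- `M, e, f ⊨ π` -/
def PathFormula.Sat {P : Type u} {A : Type v} (M : MSC P A) :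
    PathFormula P A → M.Event → M.Event → Prop
  | .next, e, f => M.proc e f
  | .prev, e, f => M.proc f e
  | .msg p q _, e, f => M.loc e = p ∧ M.loc f = q ∧ M.msg e f
  | .msgInv p q _, e, f => M.loc e = q ∧ M.loc f = p ∧ M.msg f e
  | .until φ, e, f => M.procLT e f ∧
      ∀ g, M.procLT e g → M.procLT g f → EventFormula.Sat M φ g
  | .since φ, e, f => M.procLT f e ∧
      ∀ g, M.procLT f g → M.procLT g e → EventFormula.Sat M φ g
  | .jump p r, e, f => M.loc e = p ∧ M.loc f = r
  | .test φ, e, f => e = f ∧ EventFormula.Sat M φ e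
  | .comp π₁ π₂, e, g => ∃ f, PathFormula.Sat M π₁ e f ∧ PathFormula.Sat M π₂ f g

end

open Classical in
/-- The MSC `M_φ` over `P` and `{0,1}`: every event is labelled with the truth value of `φ`. -/
noncomputable def MSC.truth {P : Type u} {A : Type v} (M : MSC P A) (φ : EventFormula P A) :
    MSC P Bool :=
  M.relabel fun e => decide (EventFormula.Sat M φ e)

-- A transducer may guess the truth values of all subformulas, provided that local constraints force
-- each guess to be exact. Negation is then free. By structural induction, what remains is to treat
-- composition of paths and `Loop`.
--
-- Every path formula denotes a relation that maps the events of one process to events of one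
-- process and is closed under uncrossing (`MSC.Regular`); for messages this is the FIFO property.
-- Therefore the first `q`-event reachable by a composed path is found by moving to the first
-- intermediate event that reaches any `q`-event (`isFirst_comp_iff`). So the property "the first
-- `q`-event of the image satisfies `q'`" can be computed compositionally (`Navigable`).
--
-- For `Loop`, uncrossing shows that `R e e` holds iff `e` has an image and a preimage and, for both
-- `R` and its converse, some edge leads from an event at or after `e` to one at or before `e` on
-- the process of `e` (`self_iff`). The last condition says `f e ≤ e`, where `f e` is the first
-- image of `e` under `≤ · R` restricted to one process. This `f` is a monotone partial function, so
-- the set of its descending points must be certified by finitely many labels.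
--
-- To this end guess the set `t` and cut the process into blocks wherever `t` drops from true to
-- false. If `f` preserves the parity `s` of the block index, monotonicity forces it to preserve the
-- block. Inside a block the points outside `t` precede those of `t`. A colouring `c` excludes `f i
-- = i` outside `t`, a colouring `d` excludes `f i = i + 1` on `t`, and induction along the block
-- yields `i < f i` and `f i ≤ i` respectively. The colourings exist because strictly increasing or
-- strictly decreasing edges of a function form a forest.

/-! ### Two-colourings and the detection of descending points of a monotone function -/

/-- The edges from `i` to `k i < i` form a forest, so the colour of `i` can be chosen by recursion
as the opposite of that of `k i`. -/
theorem exists_coloring_of_lt (k : ℕ → ℕ) :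
    ∃ d : ℕ → Prop, ∀ i, k i < i → (d (k i) ↔ ¬ d i) := by
  let d : ℕ → Prop := WellFounded.fix (r := fun a b : ℕ => a < b) wellFounded_lt
    (fun i ih => ∃ h : k i < i, ¬ ih (k i) h)
  have hd : ∀ i, d i ↔ ∃ _ : k i < i, ¬ d (k i) := fun i => by
    have := WellFounded.fix_eq (r := fun a b : ℕ => a < b) wellFounded_lt
      (C := fun _ => Prop) (fun i ih => ∃ h : k i < i, ¬ ih (k i) h) i
    exact iff_of_eq this
  refine ⟨d, fun i hi => ?_⟩
  rw [hd i]
  simp [hi]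

/-- The reflection `i ↦ n - i` turns increasing edges into decreasing ones. -/
theorem exists_coloring_of_gt (n : ℕ) (k : ℕ → ℕ) :
    ∃ c : ℕ → Prop, ∀ i, i < k i → k i < n → (c (k i) ↔ ¬ c i) := by
  obtain ⟨d, hd⟩ := exists_coloring_of_lt (fun j => n - k (n - j))
  refine ⟨fun i => d (n - i), fun i hi hn => ?_⟩
  have h := hd (n - i)
  rw [show n - (n - i) = i by omega] at h
  exact h (by omega)

open Classical in
/-- The number of positions `j < i` with `t j` and `¬ t (j + 1)`. -/
noncomputable def dropCount (t : ℕ → Prop) : ℕ → ℕ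
  | 0 => 0
  | i + 1 => dropCount t i + if t i ∧ ¬ t (i + 1) then 1 else 0

theorem dropCount_mono (t : ℕ → Prop) : Monotone (dropCount t) :=
  monotone_nat_of_le_succ fun i => by simp [dropCount]

theorem dropCount_succ_of_drop {t : ℕ → Prop} {i : ℕ} (h : t i) (h' : ¬ t (i + 1)) :
    dropCount t (i + 1) = dropCount t i + 1 := by
  simp [dropCount, h, h']

theorem dropCount_succ_of_not_drop {t : ℕ → Prop} {i : ℕ} (h : ¬ (t i ∧ ¬ t (i + 1))) :
    dropCount t (i + 1) = dropCount t i := by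
  simp only [dropCount, if_neg h, add_zero]

theorem dropCount_eq_of_forall_not_drop {t : ℕ → Prop} {i j : ℕ} (hij : i ≤ j)
    (h : ∀ k, i ≤ k → k < j → ¬ (t k ∧ ¬ t (k + 1))) : dropCount t i = dropCount t j := by
  induction j, hij using Nat.le_induction with
  | base => rfl
  | succ j hj ih =>
    rw [dropCount_succ_of_not_drop (h j hj (by omega)),
      ih fun k hk hk' => h k hk (by omega)]

/-- Local conditions on the labels `s c d` which certify that `t` is the set of `i < n`
with `f i ≤ i`, for a monotone function `f` on `{0, …, n - 1}` (where `n` is the value at the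
points outside of the domain of `f`). -/
structure DescentCertificate (n : ℕ) (f : ℕ → ℕ) (t s c d : ℕ → Prop) : Prop where
  lt_of_mem : ∀ i < n, t i → f i < n
  block : ∀ i < n, f i < n → (s (f i) ↔ s i)
  up : ∀ i < n, ¬ t i → f i < n → (c (f i) ↔ ¬ c i)
  down : ∀ i < n, t i → 0 < f i → f i < n → (d (f i - 1) ↔ ¬ d i)
  succ : ∀ i, i + 1 < n → ((s (i + 1) ↔ s i) ↔ ¬ (t i ∧ ¬ t (i + 1)))

namespace DescentCertificate

variable {n : ℕ} {f : ℕ → ℕ} {t s c d : ℕ → Prop}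

/-- The constraints determine `s` only up to a global flip, hence the comparison with `s 0`. -/
theorem block_iff (h : DescentCertificate n f t s c d) (i : ℕ) (hi : i < n) :
    (s i ↔ s 0) ↔ dropCount t i % 2 = 0 := by
  induction i with
  | zero => simp [dropCount]
  | succ i ih =>
    have h1 := h.succ i hi
    have h2 := ih (by omega)
    by_cases hd : t i ∧ ¬ t (i + 1)
    · rw [dropCount_succ_of_drop hd.1 hd.2]
      have : (dropCount t i + 1) % 2 = 0 ↔ ¬ dropCount t i % 2 = 0 := by omega
      tauto
    · rw [dropCount_succ_of_not_drop hd]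
      tauto

theorem parity (h : DescentCertificate n f t s c d) (i : ℕ) (hi : i < n) (hf : f i < n) :
    dropCount t (f i) % 2 = dropCount t i % 2 := by
  have h1 := h.block_iff i hi
  have h2 := h.block_iff (f i) hf
  rw [h.block i hi hf, h1] at h2
  omega

theorem dropCount_succ_le (t : ℕ → Prop) (i : ℕ) : dropCount t (i + 1) ≤ dropCount t i + 1 := by
  simp only [dropCount]; split_ifs <;> omega

/-- From left to right, the block index of `i` grows by at most one per step and that of `f i` never
decreases. Equal parity prevents the former from overtaking the latter. -/
theorem le_dropCount (h : DescentCertificate n f t s c d) (hf : Monotone f) (i : ℕ) (hi : i < n)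
    (hfi : f i < n) : dropCount t i ≤ dropCount t (f i) := by
  induction i with
  | zero => simp [dropCount]
  | succ i ih =>
    have h1 : f i ≤ f (i + 1) := hf (by omega)
    have h2 := ih (by omega) (by omega)
    have h3 := dropCount_mono t h1
    have h4 := h.parity _ hi hfi
    have h5 := dropCount_succ_le t i
    omega

/-- The mirror image of the preceding argument, from right to left. -/
theorem dropCount_le (h : DescentCertificate n f t s c d) (hf : Monotone f) (i : ℕ) (hi : i < n)
    (hfi : f i < n) : dropCount t (f i) ≤ dropCount t i := by
  obtain ⟨m, rfl⟩ : ∃ m, n = m + 1 := ⟨n - 1, by omega⟩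
  have him : i ≤ m := by omega
  induction him using Nat.decreasingInduction with
  | self => exact dropCount_mono t (by omega)
  | of_succ i him ih =>
    have h4 := h.parity _ hi hfi
    have h5 := dropCount_succ_le t i
    have h1 : f i ≤ f (i + 1) := hf (by omega)
    by_cases h2 : f (i + 1) < m + 1
    · have h6 := ih (by omega) h2
      have h3 := dropCount_mono t h1
      omega
    -- From `i + 1` on, `f` is undefined and so `t` is false: `i + 1` already lies in the last
    -- block.
    · have h6 : dropCount t (i + 1) = dropCount t m := by
        refine dropCount_eq_of_forall_not_drop (by omega) fun k hk hkm hd => ?_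
        have := h.lt_of_mem k (by omega) hd.1
        have := hf hk
        omega
      have h7 := dropCount_mono t (show f i ≤ m by omega)
      omega

/-- The inequality propagates rightwards through the points outside `t`. At the start of a block,
`f` cannot reach back into an earlier block. Either way `i ≤ f i`, and `c` excludes equality. -/
theorem lt_of_not_mem (h : DescentCertificate n f t s c d) (hf : Monotone f) (i : ℕ) (hi : i < n)
    (hti : ¬ t i) : i < f i := by
  have key : ∀ i < n, ¬ t i → f i ≠ i := fun i hi hti he => by
    have := h.up i hi hti (by omega)
    rw [he] at this
    tauto
  induction i with
  | zero => exact Nat.pos_of_ne_zero (key 0 hi hti)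
  | succ i ih =>
    have hk := key _ hi hti
    by_cases ht : t i
    · by_contra hlt
      have h1 := h.le_dropCount hf _ hi (by omega)
      have h2 := dropCount_mono t (show f (i + 1) ≤ i by omega)
      rw [dropCount_succ_of_drop ht hti] at h1
      omega
    · have := ih (by omega) ht
      have : f i ≤ f (i + 1) := hf (by omega)
      omega

/-- Symmetrically from the right: inside `t`, `f i ≤ f (i + 1) ≤ i + 1`, and `d` excludes `f i = i +
1`. At the end of a block, `f` cannot reach the next block. -/
theorem le_of_mem (h : DescentCertificate n f t s c d) (hf : Monotone f) (i : ℕ) (hi : i < n)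
    (hti : t i) : f i ≤ i := by
  obtain ⟨m, rfl⟩ : ∃ m, n = m + 1 := ⟨n - 1, by omega⟩
  have him : i ≤ m := by omega
  induction him using Nat.decreasingInduction with
  | self => have := h.lt_of_mem m hi hti; omega
  | of_succ i him ih =>
    have hlt := h.lt_of_mem i hi hti
    by_cases ht : t (i + 1)
    · have h1 := ih ht (by omega)
      have h2 : f i ≤ f (i + 1) := hf (by omega)
      have h3 : f i ≠ i + 1 := fun he => by
        have := h.down i hi hti (by omega) hlt
        rw [he, Nat.add_sub_cancel] at this
        tauto
      omega
    · by_contra hgt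
      have h1 := h.dropCount_le hf _ hi hlt
      have h2 := dropCount_mono t (show i + 1 ≤ f i by omega)
      rw [dropCount_succ_of_drop hti ht] at h2
      omega

theorem mem_iff (h : DescentCertificate n f t s c d) (hf : Monotone f) (i : ℕ) (hi : i < n) :
    t i ↔ f i ≤ i :=
  ⟨h.le_of_mem hf i hi, fun hle => by
    by_contra ht
    have := h.lt_of_not_mem hf i hi ht
    omega⟩

/-- For the true set of descending points, monotonicity forbids a drop between `i` and `f i`, so the
block index itself is preserved, not only its parity. -/
theorem exists_of_monotone (n : ℕ) (hf : Monotone f) (ht : ∀ i < n, t i ↔ f i ≤ i) :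
    ∃ s c d, DescentCertificate n f t s c d := by
  obtain ⟨c, hc⟩ := exists_coloring_of_gt n f
  obtain ⟨d, hd⟩ := exists_coloring_of_lt fun i => f i - 1
  refine ⟨fun i => dropCount t i % 2 = 1, c, d, ?_, ?_, ?_, ?_, ?_⟩
  · intro i hi hti
    have := (ht i hi).1 hti
    omega
  · intro i hi hfi
    suffices h : dropCount t (f i) = dropCount t i by rw [h]
    rcases le_total (f i) i with hle | hle
    · refine dropCount_eq_of_forall_not_drop hle fun k hk hki hdrop => ?_
      rw [ht (k + 1) (by omega)] at hdrop
      have := hf (show k + 1 ≤ i by omega)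
      omega
    · refine (dropCount_eq_of_forall_not_drop hle fun k hk hki hdrop => ?_).symm
      rw [ht k (by omega)] at hdrop
      have := hf hk
      omega
  · intro i hi hti hfi
    rw [ht i hi] at hti
    exact hc i (by omega) hfi
  · intro i hi hti h0 _
    rw [ht i hi] at hti
    exact hd i (by omega)
  · intro i _
    by_cases hdrop : t i ∧ ¬ t (i + 1)
    · rw [dropCount_succ_of_drop hdrop.1 hdrop.2]
      have : (dropCount t i + 1) % 2 = 1 ↔ ¬ dropCount t i % 2 = 1 := by omega
      tauto
    · rw [dropCount_succ_of_not_drop hdrop]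
      tauto

end DescentCertificate

/-! ### Positions of events on their process -/

namespace MSC

variable {P : Type u} {A : Type v} (M : MSC P A)

/-- Coordinates `(loc, pos)` for events, which turn all later arguments about the process orders
into arithmetic in `ℕ`. -/
theorem exists_pos : ∃ (len : P → ℕ) (pos : M.Event → ℕ),
    (∀ e f, M.proc e f ↔ M.loc e = M.loc f ∧ pos f = pos e + 1) ∧
    (∀ e f, M.loc e = M.loc f → pos e = pos f → e = f) ∧
    (∀ p k, k < len p ↔ ∃ f, M.loc f = p ∧ pos f = k) := by
  have := M.finite_event
  have key : ∀ p, ∃ (n : ℕ) (r : M.On p ≃ Fin n), ∀ e f : M.On p,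
      M.proc e.1 f.1 ↔ (r f : ℕ) = r e + 1 := fun p => by
    obtain ⟨o, ho⟩ := M.proc_succ p
    have := Fintype.ofFinite (M.On p)
    let r := (Fintype.orderIsoFinOfCardEq (M.On p) rfl).symm
    refine ⟨_, r.toEquiv, fun e f => ?_⟩
    rw [ho, ← apply_covBy_apply_iff r, Fin.covBy_iff, Nat.covBy_iff_add_one_eq, eq_comm]
    rfl
  choose n r hr using key
  let pos : M.Event → ℕ := fun e => r (M.loc e) ⟨e, rfl⟩
  have hpos : ∀ p (e : M.On p), (r p e : ℕ) = pos e.1 := by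
    rintro _ ⟨e, rfl⟩
    rfl
  refine ⟨n, pos, fun e f => ?_, fun e f hl he => ?_, fun p k => ⟨fun hk => ?_, ?_⟩⟩
  · constructor
    · intro h
      have hl := M.proc_loc e f h
      have := (hr (M.loc f) ⟨e, hl⟩ ⟨f, rfl⟩).1 h
      rw [hpos, hpos] at this
      exact ⟨hl, this⟩
    · rintro ⟨hl, h⟩
      refine (hr (M.loc f) ⟨e, hl⟩ ⟨f, rfl⟩).2 ?_
      rw [hpos, hpos]
      exact h
  · have : (⟨e, hl⟩ : M.On (M.loc f)) = ⟨f, rfl⟩ := (r _).injective <| Fin.ext <| by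
      rw [hpos, hpos]
      exact he
    exact congrArg Subtype.val this
  · refine ⟨((r p).symm ⟨k, hk⟩).1, ((r p).symm ⟨k, hk⟩).2, ?_⟩
    rw [← hpos, Equiv.apply_symm_apply]
  · rintro ⟨f, rfl, rfl⟩
    exact (r _ ⟨f, rfl⟩).2

/-- The number of events of a process. -/
noncomputable def len : P → ℕ := M.exists_pos.choose

/-- The number of events before `e` on the process of `e`. -/
noncomputable def pos : M.Event → ℕ := M.exists_pos.choose_spec.choose

variable {M}

theorem proc_iff {e f : M.Event} : M.proc e f ↔ M.loc e = M.loc f ∧ M.pos f = M.pos e + 1 :=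
  M.exists_pos.choose_spec.choose_spec.1 e f

theorem eq_of_pos {e f : M.Event} (h : M.loc e = M.loc f) (h' : M.pos e = M.pos f) : e = f :=
  M.exists_pos.choose_spec.choose_spec.2.1 e f h h'

theorem lt_len_iff {p : P} {k : ℕ} : k < M.len p ↔ ∃ f, M.loc f = p ∧ M.pos f = k :=
  M.exists_pos.choose_spec.choose_spec.2.2 p k

theorem pos_lt_len (e : M.Event) : M.pos e < M.len (M.loc e) :=
  lt_len_iff.2 ⟨e, rfl, rfl⟩

theorem exists_of_lt_pos (e : M.Event) {k : ℕ} (h : k < M.pos e) :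
    ∃ f, M.loc f = M.loc e ∧ M.pos f = k :=
  lt_len_iff.1 (h.trans (pos_lt_len e))

theorem procLT_iff {e f : M.Event} : M.procLT e f ↔ M.loc e = M.loc f ∧ M.pos e < M.pos f := by
  constructor
  · intro h
    induction h with
    | single h => rw [proc_iff] at h; exact ⟨h.1, by omega⟩
    | tail _ h ih => rw [proc_iff] at h; exact ⟨ih.1.trans h.1, by omega⟩
  · rintro ⟨hl, h⟩
    induction hn : M.pos f generalizing f with
    | zero => omega
    | succ n ih =>
      by_cases hne : M.pos e = n
      · exact .single (proc_iff.2 ⟨hl, by omega⟩)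
      · obtain ⟨g, hg, hgn⟩ := exists_of_lt_pos f (show n < M.pos f by omega)
        exact .tail (ih (hl.trans hg.symm) (by omega) hgn) (proc_iff.2 ⟨hg, by omega⟩)

theorem procLE_iff {e f : M.Event} : M.procLE e f ↔ M.loc e = M.loc f ∧ M.pos e ≤ M.pos f := by
  rw [procLE, Relation.reflTransGen_iff_eq_or_transGen]
  change _ ∨ M.procLT e f ↔ _
  rw [procLT_iff]
  constructor
  · rintro (rfl | h)
    · exact ⟨rfl, le_rfl⟩
    · exact ⟨h.1, h.2.le⟩
  · rintro ⟨hl, h⟩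
    rcases h.eq_or_lt with h | h
    · exact .inl (eq_of_pos hl h).symm
    · exact .inr ⟨hl, h⟩

theorem fifo_pos {e f e' f' : M.Event} (h : M.msg e f) (h' : M.msg e' f')
    (he : M.loc e = M.loc e') (hf : M.loc f = M.loc f') :
    M.pos e ≤ M.pos e' ↔ M.pos f ≤ M.pos f' := by
  have := M.fifo e f e' f' h h' he hf
  change M.procLE e e' ↔ M.procLE f f' at this
  simpa [procLE_iff, he, hf] using this

theorem forall_not_proc_left_iff {e : M.Event} : (∀ f, ¬ M.proc f e) ↔ M.pos e = 0 := by
  constructor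
  · intro h
    by_contra h0
    obtain ⟨f, hf, hk⟩ := exists_of_lt_pos e (show M.pos e - 1 < M.pos e by omega)
    exact h f (proc_iff.2 ⟨hf, by omega⟩)
  · intro h f hf
    rw [proc_iff] at hf
    omega

theorem forall_not_proc_right_iff {e : M.Event} :
    (∀ f, ¬ M.proc e f) ↔ ∀ f, M.loc f = M.loc e → M.pos f ≤ M.pos e := by
  constructor
  · intro h f hf
    by_contra hlt
    have h1 := pos_lt_len f
    obtain ⟨g, hg, hk⟩ := lt_len_iff.1 (show M.pos e + 1 < M.len (M.loc f) by omega)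
    exact h g (proc_iff.2 ⟨(hg.trans hf).symm, hk⟩)
  · intro h f hf
    rw [proc_iff] at hf
    have := h f hf.1.symm
    omega

theorem exists_last {p : P} (h : ∃ e, M.loc e = p) :
    ∃ e, M.loc e = p ∧ ∀ f, M.loc f = p → M.pos f ≤ M.pos e := by
  obtain ⟨e₀, rfl⟩ := h
  have h0 := pos_lt_len e₀
  obtain ⟨e, he, hk⟩ := lt_len_iff.1 (show M.len (M.loc e₀) - 1 < M.len (M.loc e₀) by omega)
  refine ⟨e, he, fun f hf => ?_⟩
  have := pos_lt_len f
  rw [hf] at this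
  omega

/-- Induction along the events of a process, from the first one on. -/
theorem induction_pos {C : M.Event → Prop}
    (h : ∀ e, (∀ f, M.loc f = M.loc e → M.pos f < M.pos e → C f) → C e) (e : M.Event) : C e := by
  induction hn : M.pos e using Nat.strong_induction_on generalizing e with
  | _ n ih => exact h e fun f _ hf => ih _ (hn ▸ hf) f rfl

/-- Induction along the events of a process, from the last one on. -/
theorem induction_pos_rev {C : M.Event → Prop}
    (h : ∀ e, (∀ f, M.loc f = M.loc e → M.pos e < M.pos f → C f) → C e) (e : M.Event) : C e := by
  induction hn : M.len (M.loc e) - M.pos e using Nat.strong_induction_on generalizing e with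
  | _ n ih =>
    refine h e fun f hl hf => ih _ ?_ f rfl
    have := pos_lt_len f
    rw [hl] at this ⊢
    omega

open Classical in
/-- The last event of a process. -/
noncomputable def last (M : MSC P A) (p : P) : Option M.Event :=
  if h : ∃ e, M.loc e = p ∧ ∀ f, M.loc f = p → M.pos f ≤ M.pos e then some h.choose else none

theorem last_eq_some {p : P} {e : M.Event} (he : M.loc e = p)
    (h : ∀ f, M.loc f = p → M.pos f ≤ M.pos e) : M.last p = some e := by
  have hex : ∃ e, M.loc e = p ∧ ∀ f, M.loc f = p → M.pos f ≤ M.pos e := ⟨e, he, h⟩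
  rw [last, dif_pos hex]
  have h1 := hex.choose_spec
  exact congrArg some (eq_of_pos (h1.1.trans he.symm)
    (le_antisymm (h _ h1.1) (h1.2 _ he)))

theorem last_eq_none {p : P} (h : ∀ e, M.loc e ≠ p) : M.last p = none := by
  rw [last, dif_neg]
  rintro ⟨e, he, -⟩
  exact h e he

theorem last_cases (M : MSC P A) (p : P) : (M.last p = none ∧ ∀ e, M.loc e ≠ p) ∨
    ∃ e, M.last p = some e ∧ M.loc e = p ∧ ∀ f, M.loc f = p → M.pos f ≤ M.pos e := by
  by_cases h : ∃ e, M.loc e = p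
  · obtain ⟨e, he, hmax⟩ := exists_last h
    exact .inr ⟨e, last_eq_some he hmax, he, hmax⟩
  · push Not at h
    exact .inl ⟨last_eq_none h, h⟩

open Classical in
/-- The predecessor of an event on its process. -/
noncomputable def pred (e : M.Event) : Option M.Event :=
  if h : ∃ f, M.proc f e then some h.choose else none

theorem pred_eq_some {e f : M.Event} (h : M.proc f e) : pred e = some f := by
  have hex : ∃ f, M.proc f e := ⟨f, h⟩
  rw [pred, dif_pos hex]
  have h1 := proc_iff.1 hex.choose_spec
  have h2 := proc_iff.1 h
  exact congrArg some (eq_of_pos (h1.1.trans h2.1.symm) (by omega))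

theorem pred_eq_none {e : M.Event} (h : ∀ f, ¬ M.proc f e) : pred e = none := by
  rw [pred, dif_neg]
  push Not
  exact h

end MSC

/-! ### Tilings -/

/-- A system of local constraints for labellings of the events of an MSC over `P` and `A` by
elements of `B`. -/
structure Tiling (P : Type u) (A : Type v) (B : Type) where
  node : P → A → B → Prop
  /-- constraint for the first event of a process -/
  first : P → B → Prop
  /-- constraint for consecutive events of a process -/
  succ : P → B → B → Prop
  /-- constraint for the two events of a message -/
  msg : P → P → B → B → Prop
  internal : P → B → Prop
  /-- constraint for the labels of the last events of all processes -/
  acc : (P → Option B) → Prop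

namespace Tiling

variable {P : Type u} {A : Type v} {B C : Type}

/-- The labelling `ℓ` satisfies all constraints. -/
structure Ok (T : Tiling P A B) (M : MSC P A) (ℓ : M.Event → B) : Prop where
  node : ∀ e, T.node (M.loc e) (M.lab e) (ℓ e)
  first : ∀ e, (∀ f, ¬ M.proc f e) → T.first (M.loc e) (ℓ e)
  succ : ∀ e f, M.proc e f → T.succ (M.loc e) (ℓ e) (ℓ f)
  msg : ∀ e f, M.msg e f → T.msg (M.loc e) (M.loc f) (ℓ e) (ℓ f)
  internal : ∀ e, M.IsInternal e → T.internal (M.loc e) (ℓ e)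
  acc : T.acc fun p => (M.last p).map ℓ

/-- The tiling without constraints. -/
def top : Tiling P A B where
  node _ _ _ := True
  first _ _ := True
  succ _ _ _ := True
  msg _ _ _ _ := True
  internal _ _ := True
  acc _ := True

/-- The constraints of `T`, imposed on the images of labels under `k`. -/
def comap (T : Tiling P A B) (k : C → B) : Tiling P A C where
  node p a c := T.node p a (k c)
  first p c := T.first p (k c)
  succ p c c' := T.succ p (k c) (k c')
  msg p q c c' := T.msg p q (k c) (k c')
  internal p c := T.internal p (k c)
  acc s := T.acc fun p => (s p).map k

/-- The conjunction of two systems of constraints. -/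
def inter (T T' : Tiling P A B) : Tiling P A B where
  node p a b := T.node p a b ∧ T'.node p a b
  first p b := T.first p b ∧ T'.first p b
  succ p b c := T.succ p b c ∧ T'.succ p b c
  msg p q b c := T.msg p q b c ∧ T'.msg p q b c
  internal p b := T.internal p b ∧ T'.internal p b
  acc s := T.acc s ∧ T'.acc s

theorem ok_comap {T : Tiling P A B} {k : C → B} {M : MSC P A} {ℓ : M.Event → C} :
    (T.comap k).Ok M ℓ ↔ T.Ok M (k ∘ ℓ) := by
  have h : (fun p => ((M.last p).map ℓ).map k) = fun p => (M.last p).map (k ∘ ℓ) := by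
    simp only [Option.map_map]
  constructor
  · rintro ⟨h1, h2, h3, h4, h5, h6⟩
    exact ⟨h1, h2, h3, h4, h5, (congrArg T.acc h).mp h6⟩
  · rintro ⟨h1, h2, h3, h4, h5, h6⟩
    exact ⟨h1, h2, h3, h4, h5, (congrArg T.acc h).mpr h6⟩

theorem ok_inter {T T' : Tiling P A B} {M : MSC P A} {ℓ : M.Event → B} :
    (T.inter T').Ok M ℓ ↔ T.Ok M ℓ ∧ T'.Ok M ℓ := by
  constructor
  · rintro ⟨h1, h2, h3, h4, h5, h6⟩
    exact ⟨⟨fun e => (h1 e).1, fun e h => (h2 e h).1, fun e f h => (h3 e f h).1,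
      fun e f h => (h4 e f h).1, fun e h => (h5 e h).1, h6.1⟩,
      ⟨fun e => (h1 e).2, fun e h => (h2 e h).2, fun e f h => (h3 e f h).2,
      fun e f h => (h4 e f h).2, fun e h => (h5 e h).2, h6.2⟩⟩
  · rintro ⟨⟨h1, h2, h3, h4, h5, h6⟩, ⟨h1', h2', h3', h4', h5', h6'⟩⟩
    exact ⟨fun e => ⟨h1 e, h1' e⟩, fun e h => ⟨h2 e h, h2' e h⟩,
      fun e f h => ⟨h3 e f h, h3' e f h⟩, fun e f h => ⟨h4 e f h, h4' e f h⟩,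
      fun e h => ⟨h5 e h, h5' e h⟩, h6, h6'⟩

/-- The machine which guesses a labelling satisfying the constraints: its states remember the
label of the last event, and its messages carry the label of the sending event. -/
def toCFM [Finite B] (T : Tiling P A B) : CFM P A where
  Msg := B
  finite_msg := inferInstance
  State _ := Option B
  finite_state _ := inferInstance
  init _ := none
  trans p := {t | ∃ b, t.target = some b ∧ T.node p t.action.label b ∧
    (t.source = none → T.first p b) ∧ (∀ b', t.source = some b' → T.succ p b' b) ∧
    match t.action with
    | .internal _ => T.internal p b
    | .send _ m _ _ => m = b
    | .receive _ m q _ => T.msg q p m b}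
  acc := {s | T.acc s}

open Classical in
/-- The action of the event `e` in the run of `toCFM` given by `ℓ`. -/
noncomputable def action (M : MSC P A) (ℓ : M.Event → B) {p : P} (e : M.On p) :
    CFMAction P A B p :=
  if h : ∃ f, M.msg e.1 f then
    .send (M.lab e.1) (ℓ e.1) (M.loc h.choose)
      (fun hl => M.msg_loc _ _ h.choose_spec (e.2.trans hl.symm))
  else if h : ∃ f, M.msg f e.1 then
    .receive (M.lab e.1) (ℓ h.choose) (M.loc h.choose) 
      (fun hl => M.msg_loc _ _ h.choose_spec (hl.trans e.2.symm))
  else .internal (M.lab e.1)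

theorem action_label (M : MSC P A) (ℓ : M.Event → B) {p : P} (e : M.On p) :
    (action M ℓ e).label = M.lab e.1 := by
  unfold action
  split_ifs <;> rfl

theorem action_send {M : MSC P A} (ℓ : M.Event → B) {p q : P} {e : M.On p} {f : M.On q}
    (h : M.msg e.1 f.1) : ∃ hq, action M ℓ e = .send (M.lab e.1) (ℓ e.1) q hq := by
  have hex : ∃ f, M.msg e.1 f := ⟨_, h⟩
  have hf : hex.choose = f.1 := (M.msg_unique _ _ _ _ hex.choose_spec h (.inl rfl)).2
  have hl : M.loc hex.choose = q := by rw [hf, f.2]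
  subst hl
  exact ⟨_, dif_pos hex⟩

theorem action_receive {M : MSC P A} (ℓ : M.Event → B) {p q : P} {e : M.On p} {f : M.On q}
    (h : M.msg e.1 f.1) : ∃ hp, action M ℓ f = .receive (M.lab f.1) (ℓ e.1) p hp := by
  have hno : ¬ ∃ g, M.msg f.1 g := fun ⟨g, hg⟩ => by
    have := (M.msg_unique _ _ _ _ hg h (.inr (.inl rfl))).1
    exact M.msg_loc _ _ h (by rw [this])
  have hex : ∃ g, M.msg g f.1 := ⟨_, h⟩
  have he : hex.choose = e.1 :=
    (M.msg_unique _ _ _ _ hex.choose_spec h (.inr (.inr (.inr rfl)))).1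
  have hl : M.loc hex.choose = p := by rw [he, e.2]
  subst hl
  refine ⟨fun hl => M.msg_loc _ _ hex.choose_spec (hl.trans f.2.symm),
    (dif_neg hno).trans ((dif_pos hex).trans ?_)⟩
  congr 1
  exact congrArg ℓ he

theorem action_internal {M : MSC P A} (ℓ : M.Event → B) {p : P} {e : M.On p}
    (h : M.IsInternal e.1) : action M ℓ e = .internal (M.lab e.1) := by
  unfold action
  rw [dif_neg fun ⟨f, hf⟩ => (h f).1 hf, dif_neg fun ⟨f, hf⟩ => (h f).2 hf]

/-- The target states of a run spell out a labelling. Conversely a labelling determines source,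
action and target at each event; the state `none` is only ever left at the first event of a process.
-/
theorem mem_language_toCFM [Finite B] (T : Tiling P A B) (M : MSC P A) :
    M ∈ T.toCFM.language ↔ ∃ ℓ : M.Event → B, T.Ok M ℓ := by
  constructor
  · rintro ⟨ρ, hρ, s, hs, hacc⟩
    have hmem := fun e : M.Event => hρ.mem_trans (M.loc e) ⟨e, rfl⟩
    choose ℓ hℓ hnode hfirst hsucc hact using hmem
    have htar : ∀ p (e : M.On p), (ρ p e).target = some (ℓ e.1) := by
      rintro _ ⟨e, rfl⟩
      exact hℓ e
    refine ⟨ℓ, ⟨fun e => ?_, fun e he => ?_, fun e f hef => ?_, fun e f hef => ?_,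
      fun e he => ?_, ?_⟩⟩
    · have hl := hρ.label_eq (M.loc e) ⟨e, rfl⟩
      dsimp only at hl
      rw [← hl]
      exact hnode e
    · exact hfirst e (hρ.source_init _ _ he)
    · have hl := M.proc_loc e f hef
      have h1 := hρ.proc_edge (M.loc f) ⟨e, hl⟩ ⟨f, rfl⟩ hef
      rw [htar] at h1
      rw [hl]
      exact hsucc f _ h1.symm
    · obtain ⟨a, b, m, hq, hp, h1, h2⟩ := hρ.msg_edge _ _ ⟨e, rfl⟩ ⟨f, rfl⟩ hef
      have h3 := hact e
      have h4 := hact f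
      rw [h1] at h3
      rw [h2] at h4
      change m = ℓ e at h3
      subst h3
      exact h4
    · obtain ⟨a, h1⟩ := hρ.internal _ ⟨e, rfl⟩ he
      have h3 := hact e
      rw [h1] at h3
      exact h3
    · have : s = fun p => (M.last p).map ℓ := by
        funext p
        rcases M.last_cases p with ⟨h1, h2⟩ | ⟨e, h1, h2, h3⟩
        · rw [h1]
          exact hs.2 p ⟨fun e => h2 _ e.2⟩
        · rw [h1]
          refine (hs.1 p ⟨e, h2⟩ fun f => ?_).trans (htar p ⟨e, h2⟩)
          exact MSC.procLE_iff.2 ⟨f.2.trans h2.symm, h3 _ f.2⟩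
      rw [← this]
      exact hacc
  · rintro ⟨ℓ, h⟩
    refine ⟨fun p e => ⟨(MSC.pred e.1).map ℓ, action M ℓ e, some (ℓ e.1)⟩,
      ⟨?_, fun p e => action_label M ℓ e, ?_, ?_, ?_, ?_⟩,
      fun p => (M.last p).map ℓ, ⟨?_, ?_⟩, h.acc⟩
    · rintro _ ⟨e, rfl⟩
      refine ⟨ℓ e, rfl, ?_, ?_, ?_, ?_⟩
      · dsimp only
        rw [action_label]
        exact h.node e
      · intro hs
        refine h.first e fun f hf => ?_
        simp [MSC.pred_eq_some hf] at hs
      · intro b' hs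
        by_cases hex : ∃ f, M.proc f e
        · obtain ⟨f, hf⟩ := hex
          simp only [MSC.pred_eq_some hf, Option.map_some, Option.some.injEq] at hs
          rw [← hs, ← M.proc_loc f e hf]
          exact h.succ f e hf
        · push Not at hex
          simp [MSC.pred_eq_none hex] at hs
      · dsimp only
        by_cases h1 : ∃ f, M.msg e f
        · obtain ⟨f, hf⟩ := h1
          obtain ⟨_, hact⟩ := action_send ℓ (e := ⟨e, rfl⟩) (f := ⟨f, rfl⟩) hf
          rw [hact]
        · by_cases h2 : ∃ f, M.msg f e
          · obtain ⟨f, hf⟩ := h2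
            obtain ⟨_, hact⟩ := action_receive ℓ (e := ⟨f, rfl⟩) (f := ⟨e, rfl⟩) hf
            rw [hact]
            exact h.msg f e hf
          · push Not at h1 h2
            have hint : M.IsInternal e := fun f => ⟨h1 f, h2 f⟩
            rw [action_internal ℓ (e := ⟨e, rfl⟩) hint]
            exact h.internal e hint
    · intro p e he
      simp only [MSC.pred_eq_none he]
      rfl
    · intro p e f hef
      simp only [MSC.pred_eq_some hef]
      rfl
    · exact fun p e he => ⟨_, action_internal ℓ he⟩
    · intro p q e f hef
      obtain ⟨hq, h1⟩ := action_send ℓ hef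
      obtain ⟨hp, h2⟩ := action_receive ℓ hef
      exact ⟨_, _, _, hq, hp, h1, h2⟩
    · exact fun p e he => congrArg (Option.map ℓ)
        (MSC.last_eq_some e.2 fun f hf => (MSC.procLE_iff.1 (he ⟨f, hf⟩)).2)
    · exact fun p hp => congrArg (Option.map ℓ)
        (MSC.last_eq_none fun e he => hp.false ⟨e, he⟩)

end Tiling

/-! ### Recognizable relations between MSCs and labellings of their events -/

section

variable {P : Type u} {A : Type v} {Γ Δ Θ : Type}

/-- `R` is the projection of the set of solutions of a system of local constraints. -/
def Recognizable (R : ∀ M : MSC P A, (M.Event → Γ) → Prop) : Prop :=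
  ∃ (B : Type) (_ : Finite B) (T : Tiling P A (Γ × B)),
    ∀ M γ, R M γ ↔ ∃ β : M.Event → B, T.Ok M fun e => (γ e, β e)

namespace Recognizable

theorem of_tiling {R : ∀ M : MSC P A, (M.Event → Γ) → Prop} (T : Tiling P A Γ)
    (h : ∀ M γ, R M γ ↔ T.Ok M γ) : Recognizable R :=
  ⟨Unit, inferInstance, T.comap Prod.fst, fun M γ => by
    simp only [Tiling.ok_comap, h, Function.comp_def, exists_const]⟩

theorem of_node (k : P → A → Γ → Prop) :
    Recognizable fun (M : MSC P A) (γ : M.Event → Γ) => ∀ e, k (M.loc e) (M.lab e) (γ e) :=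
  let T : Tiling P A Γ := { (Tiling.top : Tiling P A Γ) with node := k }
  of_tiling T fun _ _ => ⟨fun h => ⟨h, fun _ _ => trivial, fun _ _ _ => trivial,
    fun _ _ _ => trivial, fun _ _ => trivial, trivial⟩, fun h => h.node⟩

theorem congr {R R' : ∀ M : MSC P A, (M.Event → Γ) → Prop} (hR : Recognizable R)
    (h : ∀ M γ, R M γ ↔ R' M γ) : Recognizable R' := by
  obtain ⟨B, hB, T, hT⟩ := hR
  exact ⟨B, hB, T, fun M γ => (h M γ).symm.trans (hT M γ)⟩

theorem comap {R : ∀ M : MSC P A, (M.Event → Γ) → Prop} (hR : Recognizable R) (k : Δ → Γ) :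
    Recognizable fun M (δ : M.Event → Δ) => R M fun e => k (δ e) := by
  obtain ⟨B, hB, T, hT⟩ := hR
  refine ⟨B, hB, T.comap (Prod.map k id), fun M δ => ?_⟩
  simp only [Tiling.ok_comap, hT]
  rfl

theorem and {R R' : ∀ M : MSC P A, (M.Event → Γ) → Prop} (hR : Recognizable R)
    (hR' : Recognizable R') : Recognizable fun M γ => R M γ ∧ R' M γ := by
  obtain ⟨B, hB, T, hT⟩ := hR
  obtain ⟨B', hB', T', hT'⟩ := hR'
  refine ⟨B × B', inferInstance, (T.comap fun x => (x.1, x.2.1)).inter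
    (T'.comap fun x => (x.1, x.2.2)), fun M γ => ?_⟩
  simp only [Tiling.ok_inter, Tiling.ok_comap, hT, hT', Function.comp_def]
  exact ⟨fun ⟨⟨β, h⟩, ⟨β', h'⟩⟩ => ⟨fun e => (β e, β' e), h, h'⟩,
    fun ⟨β, h, h'⟩ => ⟨⟨_, h⟩, ⟨_, h'⟩⟩⟩

theorem exists_labelling [Finite Δ] {R : ∀ M : MSC P A, (M.Event → Γ × Δ) → Prop}
    (hR : Recognizable R) :
    Recognizable fun M γ => ∃ δ : M.Event → Δ, R M fun e => (γ e, δ e) := by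
  obtain ⟨B, hB, T, hT⟩ := hR
  refine ⟨Δ × B, inferInstance, T.comap fun x => ((x.1, x.2.1), x.2.2), fun M γ => ?_⟩
  simp only [Tiling.ok_comap, hT, Function.comp_def]
  exact ⟨fun ⟨δ, β, h⟩ => ⟨fun e => (δ e, β e), h⟩, fun ⟨x, h⟩ => ⟨_, _, h⟩⟩

end Recognizable

/-! ### Labellings computed by transducers -/

/-- The labelling `F M γ` is computed by a transducer from the MSC `M` and the labelling `γ`. -/
def Transducible (F : ∀ M : MSC P A, (M.Event → Γ) → M.Event → Δ) : Prop :=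
  Recognizable fun M (x : M.Event → Γ × Δ) => ∀ e, (x e).2 = F M (fun e => (x e).1) e

namespace Transducible

theorem pointwise (k : P → A → Γ → Δ) :
    Transducible fun (M : MSC P A) (γ : M.Event → Γ) e => k (M.loc e) (M.lab e) (γ e) :=
  Recognizable.of_node fun p a (x : Γ × Δ) => x.2 = k p a x.1

variable {F : ∀ M : MSC P A, (M.Event → Γ) → M.Event → Δ}

theorem congr {F' : ∀ M : MSC P A, (M.Event → Γ) → M.Event → Δ} (hF : Transducible F)
    (h : ∀ M γ e, F M γ e = F' M γ e) : Transducible F' := by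
  obtain rfl : F = F' := by
    funext M γ e
    exact h M γ e
  exact hF

/-- A labelling which is defined implicitly, by means of an auxiliary labelling. -/
theorem of_exists [Finite Θ] {R : ∀ M : MSC P A, (M.Event → (Γ × Δ) × Θ) → Prop}
    (hR : Recognizable R) (h : ∀ M (x : M.Event → Γ × Δ),
      (∃ θ : M.Event → Θ, R M fun e => (x e, θ e)) ↔ ∀ e, (x e).2 = F M (fun e => (x e).1) e) :
    Transducible F :=
  hR.exists_labelling.congr h

/-- The intermediate labelling is guessed, and the graph of `F` leaves only one choice. -/
theorem comp [Finite Δ] {G : ∀ M : MSC P A, (M.Event → Δ) → M.Event → Θ} (hG : Transducible G)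
    (hF : Transducible F) : Transducible fun M γ e => G M (F M γ) e := by
  refine of_exists (Θ := Δ) ((hF.comap fun x => (x.1.1, x.2)).and
    (hG.comap fun x => (x.2, x.1.2))) fun M x => ?_
  constructor
  · rintro ⟨δ, h1, h2⟩ e
    obtain rfl : δ = F M fun e => (x e).1 := funext h1
    exact h2 e
  · intro h
    exact ⟨_, fun _ => rfl, h⟩

theorem prodMk {G : ∀ M : MSC P A, (M.Event → Γ) → M.Event → Θ} (hF : Transducible F)
    (hG : Transducible G) : Transducible fun M γ e => (F M γ e, G M γ e) := by
  refine ((hF.comap fun x : Γ × Δ × Θ => (x.1, x.2.1)).and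
    (hG.comap fun x : Γ × Δ × Θ => (x.1, x.2.2))).congr fun M x => ?_
  simp only [Prod.ext_iff, forall_and]

theorem map [Finite Δ] (hF : Transducible F) (k : Δ → Θ) :
    Transducible fun M γ e => k (F M γ e) :=
  (pointwise fun _ _ => k).comp hF

variable {q q' : ∀ M : MSC P A, (M.Event → Γ) → M.Event → Prop}

protected theorem and (h : Transducible q) (h' : Transducible q') :
    Transducible fun M γ e => q M γ e ∧ q' M γ e :=
  (h.prodMk h').map fun x => x.1 ∧ x.2

protected theorem or (h : Transducible q) (h' : Transducible q') :
    Transducible fun M γ e => q M γ e ∨ q' M γ e :=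
  (h.prodMk h').map fun x => x.1 ∨ x.2

/-- No complementation of machines is involved: the computed bit is exact, so negating it is a
relabelling. -/
protected theorem not (h : Transducible q) : Transducible fun M γ e => ¬ q M γ e :=
  h.map Not

protected theorem imp (h : Transducible q) (h' : Transducible q') :
    Transducible fun M γ e => q M γ e → q' M γ e :=
  (h.prodMk h').map fun x => x.1 → x.2

theorem exists_finite {ι : Type w} [Finite ι]
    {q : ι → ∀ M : MSC P A, (M.Event → Γ) → M.Event → Prop} (h : ∀ i, Transducible (q i)) :
    Transducible fun M γ e => ∃ i, q i M γ e := by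
  revert q
  refine Finite.induction_empty_option (P := fun ι : Type w =>
    ∀ {q : ι → ∀ M : MSC P A, (M.Event → Γ) → M.Event → Prop}, (∀ i, Transducible (q i)) →
    Transducible fun M γ e => ∃ i, q i M γ e) ?_ ?_ ?_ ι
  · intro ι κ k ih q h
    refine (ih fun i => h (k i)).congr fun M γ e => propext ?_
    exact (k.surjective.exists (p := fun i => q i M γ e)).symm
  · intro q h
    refine (pointwise fun _ _ _ => False).congr fun M γ e => ?_
    simp
  · intro ι _ ih q h
    refine ((h none).or (ih fun i => h (some i))).congr fun M γ e => ?_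
    simp [Option.exists]

/-- A computed condition, imposed on all events. -/
theorem forall_event (h : Transducible q) : Recognizable fun M γ => ∀ e, q M γ e := by
  refine (Recognizable.exists_labelling (Recognizable.and h
    (Recognizable.of_node fun _ _ x => x.2))).congr fun M γ => ?_
  constructor
  · rintro ⟨δ, h1, h2⟩ e
    exact (h1 e).mp (h2 e)
  · intro h'
    exact ⟨_, fun _ => rfl, h'⟩

end Transducible

end

/-! ### Temporal operators computed by transducers -/

namespace MSC

variable {P : Type u} {A : Type v}

/-- Strict since: `b` held at an earlier event of the process, and `a` at all events since. -/
def Since (M : MSC P A) (a b : M.Event → Prop) (e : M.Event) : Prop :=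
  ∃ f, M.procLT f e ∧ (∀ g, M.procLT f g → M.procLT g e → a g) ∧ b f

/-- Strict until: `b` holds at a later event of the process, and `a` at all events before. -/
def Until (M : MSC P A) (a b : M.Event → Prop) (e : M.Event) : Prop :=
  ∃ f, M.procLT e f ∧ (∀ g, M.procLT e g → M.procLT g f → a g) ∧ b f

variable {M : MSC P A} {a b : M.Event → Prop}

/-- The unfolding law that a transducer can check along a process edge. -/
theorem since_of_proc {e f : M.Event} (h : M.proc f e) :
    M.Since a b e ↔ b f ∨ (a f ∧ M.Since a b f) := by
  have hp := proc_iff.1 h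
  simp only [Since, procLT_iff]
  constructor
  · rintro ⟨g, ⟨hg, hlt⟩, ha, hb⟩
    by_cases he : M.pos g = M.pos f
    · rw [← eq_of_pos (hg.trans hp.1.symm) he]
      exact .inl hb
    · have hgf : M.pos g < M.pos f := by omega
      exact .inr ⟨ha f ⟨hg.trans hp.1.symm, hgf⟩ ⟨hp.1, by omega⟩, g,
        ⟨hg.trans hp.1.symm, hgf⟩, fun k hk hk' => ha k hk ⟨hk'.1.trans hp.1, by omega⟩, hb⟩
  · rintro (hb | ⟨hf, g, hg, ha, hb⟩)
    · exact ⟨f, ⟨hp.1, by omega⟩, fun g hg hg' => by omega, hb⟩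
    · refine ⟨g, ⟨hg.1.trans hp.1, by omega⟩, fun k hk hk' => ?_, hb⟩
      have hl : M.loc k = M.loc f := hk'.1.trans hp.1.symm
      by_cases he : M.pos k = M.pos f
      · rwa [eq_of_pos hl he]
      · exact ha k hk ⟨hl, by omega⟩

theorem not_since_of_first {e : M.Event} (h : ∀ f, ¬ M.proc f e) : ¬ M.Since a b e := by
  rintro ⟨f, hf, -⟩
  rw [forall_not_proc_left_iff] at h
  rw [procLT_iff] at hf
  omega

theorem until_of_proc {e f : M.Event} (h : M.proc e f) :
    M.Until a b e ↔ b f ∨ (a f ∧ M.Until a b f) := by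
  have hp := proc_iff.1 h
  simp only [Until, procLT_iff]
  constructor
  · rintro ⟨g, ⟨hg, hlt⟩, ha, hb⟩
    by_cases he : M.pos g = M.pos f
    · rw [← eq_of_pos (hg.symm.trans hp.1) he]
      exact .inl hb
    · have hgf : M.pos f < M.pos g := by omega
      exact .inr ⟨ha f ⟨hp.1, by omega⟩ ⟨hp.1.symm.trans hg, hgf⟩, g,
        ⟨hp.1.symm.trans hg, hgf⟩, fun k hk hk' => ha k ⟨hp.1.trans hk.1, by omega⟩ hk', hb⟩
  · rintro (hb | ⟨hf, g, hg, ha, hb⟩)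
    · exact ⟨f, ⟨hp.1, by omega⟩, fun g hg hg' => by omega, hb⟩
    · refine ⟨g, ⟨hp.1.trans hg.1, by omega⟩, fun k hk hk' => ?_, hb⟩
      have hl : M.loc k = M.loc f := hk.1.symm.trans hp.1
      by_cases he : M.pos k = M.pos f
      · rwa [eq_of_pos hl he]
      · exact ha k ⟨hl.symm, by omega⟩ hk'

theorem not_until_of_last {e : M.Event} (h : ∀ f, M.loc f = M.loc e → M.pos f ≤ M.pos e) :
    ¬ M.Until a b e := by
  rintro ⟨f, hf, -⟩
  rw [procLT_iff] at hf
  have := h f hf.1.symm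
  omega

theorem until_false_iff {e : M.Event} :
    M.Until (fun _ => False) b e ↔ ∃ f, M.proc e f ∧ b f := by
  constructor
  · rintro ⟨f, hf, h, hb⟩
    rw [procLT_iff] at hf
    refine ⟨f, ?_, hb⟩
    by_contra hne
    rw [proc_iff] at hne
    have hlt : M.pos e + 1 < M.pos f := by
      by_contra hlt
      exact hne ⟨hf.1, by omega⟩
    obtain ⟨g, hg, hk⟩ := exists_of_lt_pos f hlt
    exact h g (procLT_iff.2 ⟨hf.1.trans hg.symm, by omega⟩) (procLT_iff.2 ⟨hg, by omega⟩)
  · rintro ⟨f, hf, hb⟩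
    exact (until_of_proc hf).2 (.inl hb)

theorem since_false_iff {e : M.Event} :
    M.Since (fun _ => False) b e ↔ ∃ f, M.proc f e ∧ b f := by
  constructor
  · intro h
    by_cases hf : ∃ f, M.proc f e
    · obtain ⟨f, hf⟩ := hf
      rw [since_of_proc hf] at h
      exact ⟨f, hf, by tauto⟩
    · push Not at hf
      exact absurd h (not_since_of_first hf)
  · rintro ⟨f, hf, hb⟩
    exact (since_of_proc hf).2 (.inl hb)

end MSC

namespace Transducible

variable {P : Type u} {A : Type v} {Γ Δ : Type}

theorem since_aux : Transducible fun (M : MSC P A) (x : M.Event → Prop × Prop) e =>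
    M.Since (fun f => (x f).1) (fun f => (x f).2) e := by
  let T : Tiling P A ((Prop × Prop) × Prop) := { (Tiling.top : Tiling P A _) with
    first := fun _ x => ¬ x.2
    succ := fun _ x y => y.2 ↔ x.1.2 ∨ (x.1.1 ∧ x.2) }
  refine .of_tiling T fun M x => ⟨fun h => ⟨fun _ => trivial, fun e he => ?_, fun e f hef => ?_,
    fun _ _ _ => trivial, fun _ _ => trivial, trivial⟩, fun h e => ?_⟩
  · change ¬ (x e).2
    rw [h e]
    exact MSC.not_since_of_first he
  · change (x f).2 ↔ _
    rw [h f, h e]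
    exact MSC.since_of_proc hef
  · apply propext
    induction e using MSC.induction_pos with
    | h e ih =>
      by_cases hf : ∃ f, M.proc f e
      · obtain ⟨f, hf⟩ := hf
        have hp := MSC.proc_iff.1 hf
        dsimp only at ih ⊢
        rw [MSC.since_of_proc hf, ← ih f hp.1 (by omega)]
        exact h.succ f e hf
      · push Not at hf
        exact iff_of_false (h.first e hf) (MSC.not_since_of_first hf)

theorem until_aux : Transducible fun (M : MSC P A) (x : M.Event → Prop × Prop) e =>
    M.Until (fun f => (x f).1) (fun f => (x f).2) e := by
  let T : Tiling P A ((Prop × Prop) × Prop) := { (Tiling.top : Tiling P A _) with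
    succ := fun _ x y => x.2 ↔ y.1.2 ∨ (y.1.1 ∧ y.2)
    -- An until fails at the last event of a process, and only the acceptance condition knows which
    -- event is last. From there the values are forced backwards.
    acc := fun s => ∀ p x, s p = some x → ¬ x.2 }
  refine .of_tiling T fun M x => ⟨fun h => ⟨fun _ => trivial, fun _ _ => trivial,
    fun e f hef => ?_, fun _ _ _ => trivial, fun _ _ => trivial, fun p y hy => ?_⟩, fun h e => ?_⟩
  · change (x e).2 ↔ _
    rw [h f, h e]
    exact MSC.until_of_proc hef
  · rcases M.last_cases p with ⟨h1, -⟩ | ⟨e, h1, h2, h3⟩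
    · simp [h1] at hy
    · simp only [h1, Option.map_some, Option.some.injEq] at hy
      subst hy h2
      rw [h e]
      exact MSC.not_until_of_last h3
  · apply propext
    induction e using MSC.induction_pos_rev with
    | h e ih =>
      by_cases hf : ∃ f, M.proc e f
      · obtain ⟨f, hf⟩ := hf
        have hp := MSC.proc_iff.1 hf
        dsimp only at ih ⊢
        rw [MSC.until_of_proc hf, ← ih f hp.1.symm (by omega)]
        exact h.succ e f hf
      · push Not at hf
        rw [MSC.forall_not_proc_right_iff] at hf
        refine iff_of_false (h.acc (M.loc e) (x e) ?_) (MSC.not_until_of_last hf)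
        simp only [MSC.last_eq_some rfl hf, Option.map_some]

theorem strictSince {a b : ∀ M : MSC P A, (M.Event → Γ) → M.Event → Prop} (ha : Transducible a)
    (hb : Transducible b) : Transducible fun M γ e => M.Since (a M γ) (b M γ) e :=
  since_aux.comp (ha.prodMk hb)

theorem strictUntil {a b : ∀ M : MSC P A, (M.Event → Γ) → M.Event → Prop} (ha : Transducible a)
    (hb : Transducible b) : Transducible fun M γ e => M.Until (a M γ) (b M γ) e :=
  until_aux.comp (ha.prodMk hb)

theorem const (d : Δ) : Transducible fun (M : MSC P A) (_ : M.Event → Γ) _ => d :=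
  pointwise fun _ _ _ => d

/-- A value which depends on the labels of the last events. -/
theorem last (G : (P → Option Γ) → Δ) :
    Transducible fun (M : MSC P A) (γ : M.Event → Γ) _ => G fun p => (M.last p).map γ := by
  let T : Tiling P A (Γ × Δ) := { (Tiling.top : Tiling P A _) with
    -- The value is guessed, kept constant along each process, and compared with the true one at the
    -- end.
    succ := fun _ x y => x.2 = y.2
    acc := fun s => ∀ p x, s p = some x → x.2 = G fun p => (s p).map Prod.fst }
  refine .of_tiling T fun M x => ⟨fun h => ⟨fun _ => trivial, fun _ _ => trivial,
    fun e f hef => (h e).trans (h f).symm, fun _ _ _ => trivial, fun _ _ => trivial,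
    fun p y hy => ?_⟩, fun h e => ?_⟩
  · simp only [Option.map_map]
    rcases M.last_cases p with ⟨h1, -⟩ | ⟨e, h1, -⟩
    · simp [h1] at hy
    · simp only [h1, Option.map_some, Option.some.injEq] at hy
      subst hy
      exact h e
  · induction e using MSC.induction_pos_rev with
    | h e ih =>
      by_cases hf : ∃ f, M.proc e f
      · obtain ⟨f, hf⟩ := hf
        have hp := MSC.proc_iff.1 hf
        exact (h.succ e f hf).trans (ih f hp.1.symm (by omega))
      · push Not at hf
        rw [MSC.forall_not_proc_right_iff] at hf
        have := h.acc (M.loc e) (x e) (by simp only [MSC.last_eq_some rfl hf, Option.map_some])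
        simpa only [Option.map_map, Function.comp_def] using this

/-- The condition that `b` holds somewhere on the process `r`. -/
theorem exists_on {b : ∀ M : MSC P A, (M.Event → Γ) → M.Event → Prop} (hb : Transducible b)
    (r : P) : Transducible fun M γ _ => ∃ f, M.loc f = r ∧ b M γ f := by
  -- At the last event of `r`, "now or at some time before" covers the whole process; a process
  -- without events yields false.
  refine ((last fun s : P → Option Prop => ∃ x ∈ s r, x).comp
    (hb.or ((const True).strictSince hb))).congr fun M γ _ => propext ?_
  rcases M.last_cases r with ⟨h1, h2⟩ | ⟨e, h1, rfl, h3⟩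
  · simp [h1, h2]
  · simp only [h1, Option.map_some, Option.mem_some_iff, exists_eq_left']
    constructor
    · rintro (h | ⟨f, hf, -, h⟩)
      · exact ⟨e, rfl, h⟩
      · exact ⟨f, (MSC.procLT_iff.1 hf).1, h⟩
    · rintro ⟨f, hf, h⟩
      rcases (h3 f hf).eq_or_lt with he | hlt
      · rw [← MSC.eq_of_pos hf he]
        exact .inl h
      · exact .inr ⟨f, MSC.procLT_iff.2 ⟨hf, hlt⟩, fun _ _ _ => trivial, h⟩

theorem receive {b : ∀ M : MSC P A, (M.Event → Γ) → M.Event → Prop} (hb : Transducible b)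
    (p q : P) : Transducible fun M γ e =>
      ∃ f, (M.loc e = q ∧ M.loc f = p ∧ M.msg f e) ∧ b M γ f := by
  suffices h : Transducible fun (M : MSC P A) (γ : M.Event → Prop) e =>
    ∃ f, (M.loc e = q ∧ M.loc f = p ∧ M.msg f e) ∧ γ f from h.comp hb
  let T : Tiling P A (Prop × Prop) := { (Tiling.top : Tiling P A _) with
    -- A send event is not a receive event, so the bit at the sending end is forced to be false.
    msg := fun p' q' x y => ¬ x.2 ∧ (y.2 ↔ q' = q ∧ p' = p ∧ x.1)
    internal := fun _ x => ¬ x.2 }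
  refine .of_tiling T fun M x => ⟨fun h => ⟨fun _ => trivial, fun _ _ => trivial,
    fun _ _ _ => trivial, fun e f hef => ⟨?_, ?_⟩, fun e he => ?_, trivial⟩,
    fun h e => propext ?_⟩
  · rw [h e]
    rintro ⟨g, ⟨-, -, hg⟩, -⟩
    have := (M.msg_unique _ _ _ _ hg hef (.inr (.inr (.inl rfl)))).1
    exact M.msg_loc _ _ hg (by rw [this])
  · rw [h f]
    constructor
    · rintro ⟨g, ⟨h1, h2, hg⟩, h3⟩
      obtain rfl := (M.msg_unique _ _ _ _ hg hef (.inr (.inr (.inr rfl)))).1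
      exact ⟨h1, h2, h3⟩
    · rintro ⟨h1, h2, h3⟩
      exact ⟨e, ⟨h1, h2, hef⟩, h3⟩
  · change ¬ (x e).2
    rw [h e]
    rintro ⟨g, ⟨-, -, hg⟩, -⟩
    exact (he g).2 hg
  · by_cases h1 : ∃ f, M.msg f e
    · obtain ⟨f, hf⟩ := h1
      refine (h.msg f e hf).2.trans ⟨fun ⟨h1, h2, h3⟩ => ⟨f, ⟨h1, h2, hf⟩, h3⟩, ?_⟩
      rintro ⟨g, ⟨h1, h2, hg⟩, h3⟩
      obtain rfl := (M.msg_unique _ _ _ _ hg hf (.inr (.inr (.inr rfl)))).1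
      exact ⟨h1, h2, h3⟩
    · refine iff_of_false ?_ fun ⟨f, ⟨_, _, hf⟩, _⟩ => h1 ⟨f, hf⟩
      by_cases h2 : ∃ f, M.msg e f
      · obtain ⟨f, hf⟩ := h2
        exact (h.msg e f hf).1
      · push Not at h1 h2
        exact h.internal e fun f => ⟨h2 f, h1 f⟩

theorem send {b : ∀ M : MSC P A, (M.Event → Γ) → M.Event → Prop} (hb : Transducible b)
    (p q : P) : Transducible fun M γ e =>
      ∃ f, (M.loc e = p ∧ M.loc f = q ∧ M.msg e f) ∧ b M γ f := by
  suffices h : Transducible fun (M : MSC P A) (γ : M.Event → Prop) e =>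
    ∃ f, (M.loc e = p ∧ M.loc f = q ∧ M.msg e f) ∧ γ f from h.comp hb
  let T : Tiling P A (Prop × Prop) := { (Tiling.top : Tiling P A _) with
    -- The sender anticipates the value at the receiving end, and the message constraint verifies it
    -- there.
    msg := fun p' q' x y => ¬ y.2 ∧ (x.2 ↔ p' = p ∧ q' = q ∧ y.1)
    internal := fun _ x => ¬ x.2 }
  refine .of_tiling T fun M x => ⟨fun h => ⟨fun _ => trivial, fun _ _ => trivial,
    fun _ _ _ => trivial, fun e f hef => ⟨?_, ?_⟩, fun e he => ?_, trivial⟩,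
    fun h e => propext ?_⟩
  · rw [h f]
    rintro ⟨g, ⟨-, -, hg⟩, -⟩
    have := (M.msg_unique _ _ _ _ hg hef (.inr (.inl rfl))).2
    exact M.msg_loc _ _ hg (by rw [this])
  · rw [h e]
    constructor
    · rintro ⟨g, ⟨h1, h2, hg⟩, h3⟩
      obtain rfl := (M.msg_unique _ _ _ _ hg hef (.inl rfl)).2
      exact ⟨h1, h2, h3⟩
    · rintro ⟨h1, h2, h3⟩
      exact ⟨f, ⟨h1, h2, hef⟩, h3⟩
  · change ¬ (x e).2
    rw [h e]
    rintro ⟨g, ⟨-, -, hg⟩, -⟩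
    exact (he g).1 hg
  · by_cases h1 : ∃ f, M.msg e f
    · obtain ⟨f, hf⟩ := h1
      refine (h.msg e f hf).2.trans ⟨fun ⟨h1, h2, h3⟩ => ⟨f, ⟨h1, h2, hf⟩, h3⟩, ?_⟩
      rintro ⟨g, ⟨h1, h2, hg⟩, h3⟩
      obtain rfl := (M.msg_unique _ _ _ _ hg hf (.inl rfl)).2
      exact ⟨h1, h2, h3⟩
    · refine iff_of_false ?_ fun ⟨f, ⟨_, _, hf⟩, _⟩ => h1 ⟨f, hf⟩
      by_cases h2 : ∃ f, M.msg f e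
      · obtain ⟨f, hf⟩ := h2
        exact (h.msg f e hf).1
      · push Not at h1 h2
        exact h.internal e fun f => ⟨h1 f, h2 f⟩

end Transducible

/-! ### Monotone relations between events -/

namespace MSC

variable {P : Type u} {A : Type v}

/-- A relation between the events of an MSC which relates the events of a process to events of a
single process (and vice versa) and which is closed under uncrossing. -/
structure Regular (M : MSC P A) (R : M.Event → M.Event → Prop) : Prop where
  loc_iff : ∀ e f e' f', R e f → R e' f' → (M.loc e = M.loc e' ↔ M.loc f = M.loc f')
  cross : ∀ e f e' f', R e f → R e' f' → M.loc e = M.loc e' → M.pos e ≤ M.pos e' →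
    M.pos f' ≤ M.pos f → R e f' ∧ R e' f

/-- `f` is a first element of the set `S` of events. -/
def IsFirst (M : MSC P A) (S : M.Event → Prop) (f : M.Event) : Prop :=
  S f ∧ ∀ g, S g → M.pos f ≤ M.pos g

variable {M : MSC P A}

theorem exists_isFirst {S : M.Event → Prop} (h : ∃ f, S f) : ∃ f, M.IsFirst S f := by
  obtain ⟨f, hf, hmin⟩ := (measure M.pos).wf.has_min {f | S f} h
  exact ⟨f, hf, fun g hg => not_lt.1 (hmin g hg)⟩

namespace Regular

variable {R R' : M.Event → M.Event → Prop}

theorem congr (h : M.Regular R) (hR : ∀ e f, R e f ↔ R' e f) : M.Regular R' := by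
  obtain rfl : R = R' := by
    funext e f
    exact propext (hR e f)
  exact h

theorem flip (h : M.Regular R) : M.Regular fun e f => R f e where
  loc_iff e f e' f' hef hef' := (h.loc_iff f e f' e' hef hef').symm
  cross e f e' f' hef hef' hl hle hle' :=
    h.cross f' e' f e hef' hef ((h.loc_iff f e f' e' hef hef').2 hl).symm hle' hle

theorem comp (h : M.Regular R) (h' : M.Regular R') :
    M.Regular fun e f => ∃ g, R e g ∧ R' g f where
  loc_iff := by
    rintro e f e' f' ⟨g, h1, h2⟩ ⟨g', h1', h2'⟩
    exact (h.loc_iff _ _ _ _ h1 h1').trans (h'.loc_iff _ _ _ _ h2 h2')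
  cross := by
    rintro e f e' f' ⟨g, h1, h2⟩ ⟨g', h1', h2'⟩ hl he hf
    have hg := (h.loc_iff _ _ _ _ h1 h1').1 hl
    rcases le_total (M.pos g) (M.pos g') with hle | hle
    · have := h'.cross _ _ _ _ h2 h2' hg hle hf
      exact ⟨⟨g, h1, this.1⟩, ⟨g', h1', this.2⟩⟩
    · have := h.cross _ _ _ _ h1 h1' hl he hle
      exact ⟨⟨g', this.1, h2'⟩, ⟨g, this.2, h2⟩⟩

theorem loc_eq (h : M.Regular R) {e f f' : M.Event} (hf : R e f) (hf' : R e f') :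
    M.loc f = M.loc f' :=
  (h.loc_iff _ _ _ _ hf hf').1 rfl

/-- Let `g` be the first intermediate event that reaches a `q`-event. If a later `g'` reached an
earlier `q`-event `f'`, uncrossing would provide an edge from `g` to `f'`. The conjunct `True`
matches the shape required by `Navigable.transducible`. -/
theorem isFirst_comp_iff (h : M.Regular R) (h' : M.Regular R') (q q' : M.Event → Prop)
    (e : M.Event) :
    (∃ f, M.IsFirst (fun f => (∃ g, R e g ∧ R' g f) ∧ q f) f ∧ q' f) ↔
      ∃ g, M.IsFirst (fun g => R e g ∧ ∃ f, M.IsFirst (fun f => R' g f ∧ q f) f ∧ True) g ∧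
        ∃ f, M.IsFirst (fun f => R' g f ∧ q f) f ∧ q' f := by
  have key : ∀ g f, M.IsFirst (fun g => R e g ∧
      ∃ f, M.IsFirst (fun f => R' g f ∧ q f) f ∧ True) g →
      M.IsFirst (fun f => R' g f ∧ q f) f →
      M.IsFirst (fun f => (∃ g, R e g ∧ R' g f) ∧ q f) f := by
    rintro g f ⟨⟨hg, -⟩, hgmin⟩ ⟨⟨hgf, hf⟩, hfmin⟩
    refine ⟨⟨⟨g, hg, hgf⟩, hf⟩, ?_⟩
    rintro f' ⟨⟨g', hg', hgf'⟩, hf'⟩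
    by_contra hlt
    obtain ⟨f'', h1⟩ := exists_isFirst (M := M) (S := fun f => R' g' f ∧ q f) ⟨f', hgf', hf'⟩
    have := h'.cross g f g' f' hgf hgf' (h.loc_eq hg hg')
      (hgmin g' ⟨hg', f'', h1, trivial⟩) (by omega)
    exact hlt (hfmin f' ⟨this.1, hf'⟩)
  constructor
  · rintro ⟨f, ⟨⟨⟨g, h1, h2⟩, h3⟩, h4⟩, h5⟩
    obtain ⟨f₁, hf₁⟩ := exists_isFirst (M := M) (S := fun f => R' g f ∧ q f) ⟨f, h2, h3⟩
    obtain ⟨g₀, hg₀⟩ := exists_isFirst (M := M) (S := fun g => R e g ∧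
      ∃ f, M.IsFirst (fun f => R' g f ∧ q f) f ∧ True) ⟨g, h1, f₁, hf₁, trivial⟩
    obtain ⟨f₀, hf₀, -⟩ := hg₀.1.2
    have hk := key g₀ f₀ hg₀ hf₀
    obtain ⟨g₁, hg₁, hgf₁⟩ := hk.1.1
    have : f₀ = f := eq_of_pos ((h.comp h').loc_eq (e := e) ⟨g₁, hg₁, hgf₁⟩ ⟨g, h1, h2⟩)
      (le_antisymm (hk.2 f ⟨⟨g, h1, h2⟩, h3⟩) (h4 f₀ hk.1))
    subst this
    exact ⟨g₀, hg₀, f₀, hf₀, h5⟩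
  · rintro ⟨g, hg, f, hf, hq⟩
    exact ⟨f, key g f hg hf, hq⟩

/-- Uncrossing an edge out of `e` with the two given edges produces images `a ≤ e ≤ b` of `e`.
Uncrossing one of these with an edge from `k` into `e` produces the loop. -/
theorem self_iff (h : M.Regular R) (e : M.Event) :
    R e e ↔ (∃ f, R e f) ∧ (∃ f, R f e) ∧
      (∃ e' f, M.loc e' = M.loc e ∧ M.loc f = M.loc e ∧ M.pos e ≤ M.pos e' ∧ R e' f ∧
        M.pos f ≤ M.pos e) ∧
      (∃ e' f, M.loc e' = M.loc e ∧ M.loc f = M.loc e ∧ M.pos e ≤ M.pos e' ∧ R f e' ∧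
        M.pos f ≤ M.pos e) := by
  constructor
  · exact fun he => ⟨⟨e, he⟩, ⟨e, he⟩, ⟨e, e, rfl, rfl, le_rfl, he, le_rfl⟩,
      ⟨e, e, rfl, rfl, le_rfl, he, le_rfl⟩⟩
  · rintro ⟨⟨g, hg⟩, ⟨k, hk⟩, ⟨e₁, f₁, he₁, hf₁, hle₁, hR₁, hle₁'⟩,
      ⟨e₂, f₂, he₂, hf₂, hle₂, hR₂, hle₂'⟩⟩
    have hlk : M.loc k = M.loc e := (h.loc_iff _ _ _ _ hk hR₂).2 he₂.symm |>.trans hf₂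
    obtain ⟨a, b, ha, hb, hae, heb⟩ : ∃ a b, R e a ∧ R e b ∧ M.pos a ≤ M.pos e ∧
        M.pos e ≤ M.pos b := by
      rcases le_total (M.pos g) (M.pos e) with hle | hle
      · exact ⟨g, e₂, hg, (h.cross _ _ _ _ hR₂ hg hf₂ hle₂' (hle.trans hle₂)).2, hle, hle₂⟩
      · exact ⟨f₁, g, (h.cross _ _ _ _ hg hR₁ he₁.symm hle₁ (hle₁'.trans hle)).1, hg, hle₁', hle⟩
    rcases le_total (M.pos e) (M.pos k) with hle | hle
    · exact (h.cross _ _ _ _ hb hk hlk.symm hle heb).1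
    · exact (h.cross _ _ _ _ hk ha hlk hle hae).2

end Regular

/-- The conditions of a `DescentCertificate`, for the partial function which maps an event to the
first element of its image under `R`. -/
structure IsCertificate (M : MSC P A) (p : P) (R : M.Event → M.Event → Prop)
    (t s c d : M.Event → Prop) : Prop where
  exists_of_mem : ∀ e, t e → ∃ g, R e g
  block : ∀ e g, M.IsFirst (R e) g → (s g ↔ s e)
  up : ∀ e g, M.IsFirst (R e) g → ¬ t e → (c g ↔ ¬ c e)
  down : ∀ e g, M.IsFirst (R e) g → t e → ∀ g', M.proc g' g → (d g' ↔ ¬ d e)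
  succ : ∀ e e', M.proc e e' → M.loc e' = p → ((s e' ↔ s e) ↔ ¬ (t e ∧ ¬ t e'))

/-- The position of the first element of the image of the `i`-th event of `p`, and the number of
events of `p` if there is none. -/
noncomputable def firstPos (M : MSC P A) (p : P) (R : M.Event → M.Event → Prop) (i : ℕ) : ℕ :=
  sInf (insert (M.len p) {k | ∃ e g, M.pos e = i ∧ R e g ∧ M.pos g = k})

section firstPos

variable {p : P} {R : M.Event → M.Event → Prop}

theorem firstPos_eq (hp : ∀ e f, R e f → M.loc e = p ∧ M.loc f = p)
    {e g : M.Event} (h : M.IsFirst (R e) g) :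
    M.firstPos p R (M.pos e) = M.pos g := by
  have hl := hp e g h.1
  apply le_antisymm
  · exact Nat.sInf_le (.inr ⟨e, g, rfl, h.1, rfl⟩)
  · refine le_csInf (Set.insert_nonempty _ _) ?_
    rintro k (rfl | ⟨e', g', he, hg, rfl⟩)
    · have := pos_lt_len g
      rw [hl.2] at this
      exact this.le
    · rw [eq_of_pos ((hp _ _ hg).1.trans hl.1.symm) he] at hg
      exact h.2 g' hg

theorem exists_isFirst_of_firstPos_lt
    (hp : ∀ e f, R e f → M.loc e = p ∧ M.loc f = p)
    {e : M.Event} (he : M.loc e = p)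
    (h : M.firstPos p R (M.pos e) < M.len p) :
    ∃ g, M.IsFirst (R e) g ∧ M.pos g = M.firstPos p R (M.pos e) := by
  have hmem : M.firstPos p R (M.pos e) ∈ _ := Nat.sInf_mem (Set.insert_nonempty _ _)
  rcases hmem with hmem | ⟨e', g, he', hg, -⟩
  · omega
  · rw [eq_of_pos ((hp _ _ hg).1.trans he.symm) he'] at hg
    obtain ⟨g, hg⟩ := exists_isFirst (M := M) ⟨g, hg⟩
    exact ⟨g, hg, (firstPos_eq hp hg).symm⟩

/-- Images shrink as the event moves to the right, so their minima move to the right; the default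
`M.len p` lies beyond all of them. -/
theorem firstPos_mono
    (hR : ∀ e e' f, M.loc e = M.loc e' → M.pos e ≤ M.pos e' → R e' f → R e f) :
    Monotone (M.firstPos p R) := by
  intro i j hij
  refine csInf_le_csInf' (Set.insert_nonempty _ _) (Set.insert_subset_insert ?_)
  rintro k ⟨e, g, rfl, hg, rfl⟩
  obtain ⟨e', he', rfl⟩ := lt_len_iff.1 (hij.trans_lt (pos_lt_len e))
  exact ⟨e', g, rfl, hR _ _ _ he' hij hg, rfl⟩

theorem firstPos_le_iff (hp : ∀ e f, R e f → M.loc e = p ∧ M.loc f = p)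
    {e : M.Event} (he : M.loc e = p) :
    M.firstPos p R (M.pos e) ≤ M.pos e ↔ ∃ g, R e g ∧ M.pos g ≤ M.pos e := by
  constructor
  · intro h
    have hlt := pos_lt_len e
    rw [he] at hlt
    obtain ⟨g, hg, hgp⟩ := exists_isFirst_of_firstPos_lt hp he (h.trans_lt hlt)
    exact ⟨g, hg.1, hgp ▸ h⟩
  · rintro ⟨g, hg, hle⟩
    obtain ⟨g', hg'⟩ := exists_isFirst (M := M) ⟨g, hg⟩
    rw [firstPos_eq hp hg']
    exact (hg'.2 g hg).trans hle

theorem exists_isCertificate_iff (hp : ∀ e f, R e f → M.loc e = p ∧ M.loc f = p)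
    (hR : ∀ e e' f, M.loc e = M.loc e' → M.pos e ≤ M.pos e' → R e' f → R e f)
    (t : M.Event → Prop) :
    (∃ s c d, M.IsCertificate p R t s c d) ↔
      ∀ e, t e ↔ ∃ g, R e g ∧ M.pos g ≤ M.pos e := by
  -- Transport of predicates from the events of `p` to positions; the result is false outside `{0,
  -- …, M.len p - 1}`.
  let N : (M.Event → Prop) → ℕ → Prop := fun b i => ∃ e, M.loc e = p ∧ M.pos e = i ∧ b e
  have hN : ∀ b e, M.loc e = p → (N b (M.pos e) ↔ b e) := fun b e he =>
    ⟨fun ⟨e', hl, hpe, hb⟩ => eq_of_pos (hl.trans he.symm) hpe ▸ hb, fun h => ⟨e, he, rfl, h⟩⟩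
  constructor
  · rintro ⟨s, c, d, h⟩ e
    have hcert : DescentCertificate (M.len p) (M.firstPos p R) (N t) (N s) (N c) (N d) := by
      refine ⟨fun i hi hti => ?_, fun i hi hfi => ?_, fun i hi hti hfi => ?_,
        fun i hi hti h0 hfi => ?_, fun i hi => ?_⟩
      · obtain ⟨e, he, rfl, hte⟩ := hti
        obtain ⟨g, hg⟩ := exists_isFirst (M := M) (h.exists_of_mem e hte)
        rw [firstPos_eq hp hg, ← (hp _ _ hg.1).2]
        exact pos_lt_len g
      · obtain ⟨e, he, rfl⟩ := lt_len_iff.1 hi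
        obtain ⟨g, hg, hpg⟩ := exists_isFirst_of_firstPos_lt hp he hfi
        rw [← hpg, hN _ _ he, hN _ _ (hp _ _ hg.1).2]
        exact h.block e g hg
      · obtain ⟨e, he, rfl⟩ := lt_len_iff.1 hi
        obtain ⟨g, hg, hpg⟩ := exists_isFirst_of_firstPos_lt hp he hfi
        rw [hN _ _ he] at hti
        rw [← hpg, hN _ _ he, hN _ _ (hp _ _ hg.1).2]
        exact h.up e g hg hti
      · obtain ⟨e, he, rfl⟩ := lt_len_iff.1 hi
        obtain ⟨g, hg, hpg⟩ := exists_isFirst_of_firstPos_lt hp he hfi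
        rw [hN _ _ he] at hti
        rw [← hpg] at h0 ⊢
        obtain ⟨g', hg', hpg'⟩ := exists_of_lt_pos g (show M.pos g - 1 < M.pos g by omega)
        rw [← hpg', hN _ _ he, hN _ _ (hg'.trans (hp _ _ hg.1).2)]
        exact h.down e g hg hti g' (proc_iff.2 ⟨hg', by omega⟩)
      · obtain ⟨e', he', hpe'⟩ := lt_len_iff.1 hi
        obtain ⟨e, he, rfl⟩ := lt_len_iff.1 (show i < M.len p by omega)
        rw [← hpe', hN _ _ he, hN _ _ he', hN _ _ he, hN _ _ he']
        exact h.succ e e' (proc_iff.2 ⟨he.trans he'.symm, hpe'⟩) he'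
    by_cases he : M.loc e = p
    · rw [← hN t e he, ← firstPos_le_iff hp he]
      exact hcert.mem_iff (firstPos_mono hR) _ (he ▸ pos_lt_len e)
    · refine iff_of_false (fun hte => ?_) fun ⟨g, hg, _⟩ => he (hp _ _ hg).1
      obtain ⟨g, hg⟩ := h.exists_of_mem e hte
      exact he (hp _ _ hg).1
  · intro h
    obtain ⟨s, c, d, hc⟩ := DescentCertificate.exists_of_monotone (t := N t) (M.len p)
      (firstPos_mono hR) fun i hi => by
        obtain ⟨e, he, rfl⟩ := lt_len_iff.1 hi
        rw [hN _ _ he, h, firstPos_le_iff hp he]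
    have hlt : ∀ e, M.loc e = p → M.pos e < M.len p := fun e he => he ▸ pos_lt_len e
    refine ⟨fun e => s (M.pos e), fun e => c (M.pos e), fun e => d (M.pos e), fun e he => ?_,
      fun e g hg => ?_, fun e g hg hte => ?_, fun e g hg hte g' hg' => ?_, fun e e' hee hl => ?_⟩
    · obtain ⟨g, hg, -⟩ := (h e).1 he
      exact ⟨g, hg⟩
    · obtain ⟨he, hl⟩ := hp _ _ hg.1
      have := hc.block _ (hlt e he)
      rw [firstPos_eq hp hg] at this
      exact this (hlt g hl)
    · obtain ⟨he, hl⟩ := hp _ _ hg.1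
      have := hc.up _ (hlt e he)
      rw [firstPos_eq hp hg, hN _ _ he] at this
      exact this hte (hlt g hl)
    · obtain ⟨he, hl⟩ := hp _ _ hg.1
      have h1 := hc.down _ (hlt e he)
      have h2 := proc_iff.1 hg'
      rw [firstPos_eq hp hg, hN _ _ he, h2.2] at h1
      exact h1 hte (by omega) (h2.2 ▸ hlt g hl)
    · have h1 := proc_iff.1 hee
      have h2 := hc.succ (M.pos e)
      rw [← h1.2, hN _ _ hl, hN _ _ (h1.1.trans hl)] at h2
      exact h2 (hlt e' hl)

end firstPos

end MSC

/-! ### Navigable relations -/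

section

variable {P : Type u} {A : Type v} {Γ Δ Θ : Type}

/-- A family of regular relations for which a transducer computes whether the first event in the
image of an event which satisfies a first condition also satisfies a second one. -/
structure Navigable (R : ∀ M : MSC P A, M.Event → M.Event → Prop) : Prop where
  regular : ∀ M : MSC P A, M.Regular (R M)
  transducible : ∀ {Γ : Type} {q q' : ∀ M : MSC P A, (M.Event → Γ) → M.Event → Prop},
    Transducible q → Transducible q' → Transducible fun M γ e =>
      ∃ f, M.IsFirst (fun f => R M e f ∧ q M γ f) f ∧ q' M γ f

namespace Navigable

variable {R R' : ∀ M : MSC P A, M.Event → M.Event → Prop}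

theorem congr (h : Navigable R) (hR : ∀ M e f, R M e f ↔ R' M e f) : Navigable R' := by
  obtain rfl : R = R' := by
    funext M e f
    exact propext (hR M e f)
  exact h

theorem diamond (h : Navigable R) {q : ∀ M : MSC P A, (M.Event → Γ) → M.Event → Prop}
    (hq : Transducible q) : Transducible fun M γ e => ∃ f, R M e f ∧ q M γ f := by
  refine (h.transducible hq (.const True)).congr fun M γ e => propext ⟨?_, fun hex => ?_⟩
  · rintro ⟨f, hf, -⟩
    exact ⟨f, hf.1⟩
  · obtain ⟨f, hf⟩ := MSC.exists_isFirst hex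
    exact ⟨f, hf, trivial⟩

/-- The conditions handed to `h` are themselves computed with `h'`, which is why `Navigable` allows
arbitrary transducible conditions. -/
theorem comp (h : Navigable R) (h' : Navigable R') :
    Navigable fun M e f => ∃ g, R M e g ∧ R' M g f where
  regular M := (h.regular M).comp (h'.regular M)
  transducible hq hq' :=
    (h.transducible (h'.transducible hq (.const True)) (h'.transducible hq hq')).congr
      fun M _ e => propext ((h.regular M).isFirst_comp_iff (h'.regular M) _ _ e).symm

/-- Relations which are partial functions. -/
theorem of_functional (hreg : ∀ M : MSC P A, M.Regular (R M))
    (hR : ∀ M e f f', R M e f → R M e f' → f = f')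
    (h : ∀ {Γ : Type} {q : ∀ M : MSC P A, (M.Event → Γ) → M.Event → Prop}, Transducible q →
      Transducible fun M γ e => ∃ f, R M e f ∧ q M γ f) : Navigable R where
  regular := hreg
  transducible hq hq' := (h (hq.and hq')).congr fun M _ _ => propext
    ⟨fun ⟨f, h1, h2, h3⟩ => ⟨f, ⟨⟨h1, h2⟩, fun _ hg => (hR M _ _ _ h1 hg.1 ▸ le_rfl)⟩, h3⟩,
      fun ⟨f, h1, h2⟩ => ⟨f, h1.1.1, h1.1.2, h2⟩⟩

/-- A condition on an event and the first event of its image. -/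
theorem forall_isFirst (h : Navigable R) [Finite Δ] [Finite Θ]
    {F : ∀ M : MSC P A, (M.Event → Γ) → M.Event → Δ}
    {G : ∀ M : MSC P A, (M.Event → Γ) → M.Event → Θ}
    (hF : Transducible F) (hG : Transducible G) (Q : Δ → Θ → Prop) :
    Transducible fun M γ e => ∀ g, M.IsFirst (R M e) g → Q (F M γ e) (G M γ g) := by
  -- Finitely many values `d` of `F` at `e` are tried, so that the condition at the first image
  -- mentions only `d`.
  refine (Transducible.not (Transducible.exists_finite fun d : Δ => (hF.map fun x => x = d).and
    (h.transducible (.const True) (hG.map fun y => ¬ Q d y)))).congr fun M γ e => ?_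
  simp

end Navigable

end

namespace MSC

variable {P : Type u} {A : Type v} (M : MSC P A)

theorem regular_proc : M.Regular M.proc where
  loc_iff e f e' f' h h' := by rw [M.proc_loc _ _ h, M.proc_loc _ _ h']
  cross e f e' f' h h' hl hle hle' := by
    have h1 := proc_iff.1 h
    have h2 := proc_iff.1 h'
    obtain rfl : e = e' := eq_of_pos hl (by omega)
    exact ⟨h', h⟩

/-- This is where FIFO enters: it leaves no two distinct messages to uncross. -/
theorem regular_msg (p q : P) :
    M.Regular fun e f => M.loc e = p ∧ M.loc f = q ∧ M.msg e f where
  loc_iff e f e' f' h h' := by simp [h, h']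
  cross := by
    rintro e f e' f' ⟨rfl, rfl, h⟩ ⟨h1, h2, h'⟩ hl hle hle'
    have hff := (fifo_pos h h' h1.symm h2.symm).1 hle
    obtain rfl : f = f' := eq_of_pos h2.symm (le_antisymm hff hle')
    exact ⟨⟨rfl, rfl, h⟩, h1, h2, h'⟩

theorem regular_until (φ : M.Event → Prop) : M.Regular fun e f => M.procLT e f ∧
    ∀ g, M.procLT e g → M.procLT g f → φ g where
  loc_iff e f e' f' h h' := by rw [(procLT_iff.1 h.1).1, (procLT_iff.1 h'.1).1]
  cross e f e' f' h h' hl hle hle' := by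
    simp only [procLT_iff] at h h' ⊢
    obtain ⟨⟨h1, h2⟩, h3⟩ := h
    obtain ⟨⟨h1', h2'⟩, h3'⟩ := h'
    refine ⟨⟨⟨hl.trans h1', by omega⟩, fun g hg hg' => h3 g hg ⟨hg.1.symm.trans h1, by omega⟩⟩,
      ⟨⟨hl.symm.trans h1, by omega⟩, fun g hg hg' => h3 g ⟨hl.trans hg.1, by omega⟩ hg'⟩⟩

theorem regular_le : M.Regular fun e f => M.loc e = M.loc f ∧ M.pos e ≤ M.pos f where
  loc_iff e f e' f' h h' := by rw [h.1, h'.1]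
  cross e f e' f' h h' hl hle hle' :=
    ⟨⟨hl.trans h'.1, by omega⟩, ⟨hl.symm.trans h.1, by omega⟩⟩

theorem regular_jump (p r : P) : M.Regular fun e f => M.loc e = p ∧ M.loc f = r where
  loc_iff e f e' f' h h' := by simp [h, h']
  cross e f e' f' h h' _ _ _ := ⟨⟨h.1, h'.2⟩, ⟨h'.1, h.2⟩⟩

theorem regular_test (φ : M.Event → Prop) : M.Regular fun e f => e = f ∧ φ e where
  loc_iff := by
    rintro e _ e' _ ⟨rfl, -⟩ ⟨rfl, -⟩
    rfl
  cross := by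
    rintro e _ e' _ ⟨rfl, h⟩ ⟨rfl, h'⟩ hl hle hle'
    obtain rfl := eq_of_pos hl (le_antisymm hle hle')
    exact ⟨⟨rfl, h⟩, ⟨rfl, h⟩⟩

end MSC

namespace Navigable

variable {P : Type u} {A : Type v}

theorem next : Navigable fun (M : MSC P A) e f => M.proc e f :=
  .of_functional (fun M => M.regular_proc)
    (fun M e f f' h h' => by
      rw [MSC.proc_iff] at h h'
      exact MSC.eq_of_pos (h.1.symm.trans h'.1) (by omega))
    fun hq => ((Transducible.const False).strictUntil hq).congr
      fun M γ e => propext MSC.until_false_iff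

theorem prev : Navigable fun (M : MSC P A) e f => M.proc f e :=
  .of_functional (fun M => M.regular_proc.flip)
    (fun M e f f' h h' => by
      rw [MSC.proc_iff] at h h'
      exact MSC.eq_of_pos (h.1.trans h'.1.symm) (by omega))
    fun hq => ((Transducible.const False).strictSince hq).congr
      fun M γ e => propext MSC.since_false_iff

theorem msg (p q : P) :
    Navigable fun (M : MSC P A) e f => M.loc e = p ∧ M.loc f = q ∧ M.msg e f :=
  .of_functional (fun M => M.regular_msg p q)
    (fun M _ _ _ h h' => (M.msg_unique _ _ _ _ h.2.2 h'.2.2 (.inl rfl)).2)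
    fun hq => hq.send p q

theorem msgInv (p q : P) :
    Navigable fun (M : MSC P A) e f => M.loc e = q ∧ M.loc f = p ∧ M.msg f e :=
  .of_functional (fun M => (M.regular_msg p q).flip.congr fun e f => by tauto)
    (fun M e f f' h h' => (M.msg_unique _ _ _ _ h.2.2 h'.2.2 (.inr (.inr (.inr rfl)))).1)
    fun hq => hq.receive p q

theorem test {φ : ∀ M : MSC P A, M.Event → Prop}
    (hφ : ∀ {Γ : Type}, Transducible fun M (_ : M.Event → Γ) e => φ M e) :
    Navigable fun (M : MSC P A) e f => e = f ∧ φ M e :=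
  .of_functional (fun M => M.regular_test _) (fun _ _ _ _ h h' => h.1.symm.trans h'.1)
    fun hq => (hφ.and hq).congr fun _ _ e => propext
      ⟨fun h => ⟨e, ⟨rfl, h.1⟩, h.2⟩, fun ⟨_, ⟨he, h⟩, hf⟩ => ⟨h, he ▸ hf⟩⟩

theorem strictUntil {φ : ∀ M : MSC P A, M.Event → Prop}
    (hφ : ∀ {Γ : Type}, Transducible fun M (_ : M.Event → Γ) e => φ M e) :
    Navigable fun (M : MSC P A) e f => M.procLT e f ∧
      ∀ g, M.procLT e g → M.procLT g f → φ M g where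
  regular M := M.regular_until _
  -- Requiring `¬ q` on the way makes the `q`-event that is reached the first one.
  transducible hq hq' := ((hφ.and hq.not).strictUntil (hq.and hq')).congr fun M γ e => by
    apply propext
    constructor
    · rintro ⟨f, hf, h, h1, h2⟩
      refine ⟨f, ⟨⟨⟨hf, fun g hg hg' => (h g hg hg').1⟩, h1⟩, fun g ⟨⟨hg, _⟩, hqg⟩ => ?_⟩, h2⟩
      by_contra hlt
      have h3 := MSC.procLT_iff.1 hf
      have h4 := MSC.procLT_iff.1 hg
      exact (h g hg (MSC.procLT_iff.2 ⟨h4.1.symm.trans h3.1, by omega⟩)).2 hqg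
    · rintro ⟨f, ⟨⟨⟨hf, h⟩, h1⟩, hmin⟩, h2⟩
      refine ⟨f, hf, fun g hg hg' => ⟨h g hg hg', fun hqg => ?_⟩, h1, h2⟩
      have h3 := hmin g ⟨⟨hg, fun k hk hk' => h k hk (hk'.trans hg')⟩, hqg⟩
      have h4 := MSC.procLT_iff.1 hg'
      omega

theorem strictSince {φ : ∀ M : MSC P A, M.Event → Prop}
    (hφ : ∀ {Γ : Type}, Transducible fun M (_ : M.Event → Γ) e => φ M e) :
    Navigable fun (M : MSC P A) e f => M.procLT f e ∧
      ∀ g, M.procLT f g → M.procLT g e → φ M g where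
  regular M := (M.regular_until _).flip
  -- Towards the past, the first event of the image is the farthest one: no earlier `q`-event may be
  -- reachable by continuing through `f` along `φ`-events.
  transducible hq hq' := (hφ.strictSince ((hq.and hq').and
      (hφ.and (hφ.strictSince hq)).not)).congr fun M γ e => by
    apply propext
    constructor
    · rintro ⟨f, hf, h, ⟨h1, h2⟩, hn⟩
      refine ⟨f, ⟨⟨⟨hf, h⟩, h1⟩, fun g ⟨⟨hg, hg'⟩, hqg⟩ => ?_⟩, h2⟩
      by_contra hlt
      have h3 := MSC.procLT_iff.1 hf
      have h4 := MSC.procLT_iff.1 hg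
      have hgf : M.procLT g f := MSC.procLT_iff.2 ⟨h4.1.trans h3.1.symm, by omega⟩
      exact hn ⟨hg' f hgf hf, g, hgf, fun k hk hk' => hg' k hk (hk'.trans hf), hqg⟩
    · rintro ⟨f, ⟨⟨⟨hf, h⟩, h1⟩, hmin⟩, h2⟩
      refine ⟨f, hf, h, ⟨h1, h2⟩, ?_⟩
      rintro ⟨hφf, g, hg, hg', hqg⟩
      have h3 := MSC.procLT_iff.1 hg
      have h4 := hmin g ⟨⟨hg.trans hf, fun k hk hk' => ?_⟩, hqg⟩
      · omega
      · have h5 := MSC.procLT_iff.1 hk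
        have hl : M.loc k = M.loc f := h5.1.symm.trans h3.1
        rcases lt_trichotomy (M.pos k) (M.pos f) with hlt | he | hlt
        · exact hg' k hk (MSC.procLT_iff.2 ⟨hl, hlt⟩)
        · rwa [MSC.eq_of_pos hl he]
        · exact h k (MSC.procLT_iff.2 ⟨hl.symm, hlt⟩) hk'

theorem le : Navigable fun (M : MSC P A) e f => M.loc e = M.loc f ∧ M.pos e ≤ M.pos f where
  regular M := M.regular_le
  transducible hq hq' := ((hq.and hq').or (hq.not.and
      (hq.not.strictUntil (hq.and hq')))).congr fun M γ e => by
    apply propext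
    constructor
    · rintro (⟨h1, h2⟩ | ⟨hn, f, hf, h, h1, h2⟩)
      · exact ⟨e, ⟨⟨⟨rfl, le_rfl⟩, h1⟩, fun g hg => hg.1.2⟩, h2⟩
      · have h3 := MSC.procLT_iff.1 hf
        refine ⟨f, ⟨⟨⟨h3.1, h3.2.le⟩, h1⟩, fun g ⟨⟨hl, hg⟩, hqg⟩ => ?_⟩, h2⟩
        by_contra hlt
        rcases hg.eq_or_lt with he | hg
        · exact hn (MSC.eq_of_pos hl he ▸ hqg)
        · exact h g (MSC.procLT_iff.2 ⟨hl, hg⟩)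
            (MSC.procLT_iff.2 ⟨hl.symm.trans h3.1, by omega⟩) hqg
    · rintro ⟨f, ⟨⟨⟨hl, hf⟩, h1⟩, hmin⟩, h2⟩
      rcases hf.eq_or_lt with he | hf
      · obtain rfl := MSC.eq_of_pos hl he
        exact .inl ⟨h1, h2⟩
      · refine .inr ⟨fun hqe => ?_, f, MSC.procLT_iff.2 ⟨hl, hf⟩, fun g hg hg' hqg => ?_, h1, h2⟩
        · have := hmin e ⟨⟨rfl, le_rfl⟩, hqe⟩
          omega
        · rw [MSC.procLT_iff] at hg hg'
          have := hmin g ⟨⟨hg.1, hg.2.le⟩, hqg⟩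
          omega

theorem jump (p r : P) : Navigable fun (M : MSC P A) e f => M.loc e = p ∧ M.loc f = r where
  regular M := M.regular_jump p r
  transducible hq hq' := ((Transducible.pointwise fun p' _ _ => p' = p).and
      (((hq.and hq').and ((Transducible.const True).strictSince hq).not).exists_on r)).congr
      fun M γ e => by
    apply propext
    constructor
    · rintro ⟨he, f, hf, ⟨h1, h2⟩, h3⟩
      refine ⟨f, ⟨⟨⟨he, hf⟩, h1⟩, fun g ⟨⟨_, hg⟩, hqg⟩ => ?_⟩, h2⟩
      by_contra hlt
      exact h3 ⟨g, MSC.procLT_iff.2 ⟨hg.trans hf.symm, by omega⟩, fun _ _ _ => trivial, hqg⟩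
    · rintro ⟨f, ⟨⟨⟨he, hf⟩, h1⟩, hmin⟩, h2⟩
      refine ⟨he, f, hf, ⟨h1, h2⟩, ?_⟩
      rintro ⟨g, hg, -, hqg⟩
      rw [MSC.procLT_iff] at hg
      have := hmin g ⟨⟨he, hg.1.trans hf⟩, hqg⟩
      omega

end Navigable

/-! ### The loop modality -/

namespace Navigable

variable {P : Type u} {A : Type v} {Γ : Type}
  {R : ∀ M : MSC P A, M.Event → M.Event → Prop}

/-- The descending points of the first-image map are guessed together with a certificate. Its
conditions involve only an event, its first image and predecessors, all within reach of `Navigable`.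
-/
theorem exists_le {p : P} (h : Navigable R)
    (hp : ∀ M e f, R M e f → M.loc e = p ∧ M.loc f = p)
    (hR : ∀ (M : MSC P A) e e' f, M.loc e = M.loc e' → M.pos e ≤ M.pos e' → R M e' f → R M e f) :
    Transducible fun M (_ : M.Event → Γ) e => ∃ g, R M e g ∧ M.pos g ≤ M.pos e := by
  -- Letters have the form `((γ, t), s, c, d)`.
  have lab {Δ : Type} (k : (Γ × Prop) × Prop × Prop × Prop → Δ) : Transducible
      fun (M : MSC P A) (x : M.Event → (Γ × Prop) × Prop × Prop × Prop) e => k (x e) :=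
    .pointwise fun _ _ => k
  have h0 := (lab fun x => x.1.2).imp (h.diamond (.const True))
  have h1 := h.forall_isFirst (lab fun x => (x.1.2, x.2.1, x.2.2.1))
    (lab fun x => (x.2.1, x.2.2.1)) fun x y => (y.1 ↔ x.2.1) ∧ (¬ x.1 → (y.2 ↔ ¬ x.2.2))
  -- The first image may lack a predecessor, so two bits are read there: a predecessor with `d`
  -- exists, and one with `¬ d` exists.
  have h2 := h.forall_isFirst (lab fun x => (x.1.2, x.2.2.2))
    ((prev.diamond (lab fun x => x.2.2.2)).prodMk (prev.diamond (lab fun x => ¬ x.2.2.2)))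
    fun x y => x.1 → (x.2 → ¬ y.1) ∧ (¬ x.2 → ¬ y.2)
  have h3 := (Transducible.pointwise fun p' _ _ => p' = p).imp
    (prev.forall_isFirst (lab fun x => (x.1.2, x.2.1)) (lab fun x => (x.1.2, x.2.1))
    fun x y => (x.2 ↔ y.2) ↔ ¬ (y.1 ∧ ¬ x.1))
  refine .of_exists (((h0.and h1).and (h2.and h3)).forall_event) fun M x => ?_
  have key := MSC.exists_isCertificate_iff (hp M) (hR M) fun e => (x e).2
  simp only [eq_iff_iff]
  rw [← key]
  constructor
  · rintro ⟨θ, hθ⟩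
    refine ⟨fun e => (θ e).1, fun e => (θ e).2.1, fun e => (θ e).2.2, fun e he => ?_,
      fun e g hg => ?_, fun e g hg he => ?_, fun e g hg he g' hg' => ?_, fun e e' hee he' => ?_⟩
    · obtain ⟨g, hg, -⟩ := (hθ e).1.1 he
      exact ⟨g, hg⟩
    · exact ((hθ e).1.2 g hg).1
    · exact ((hθ e).1.2 g hg).2 he
    · have h4 := (hθ e).2.1 g hg he
      constructor
      · exact fun h5 h6 => h4.1 h6 ⟨g', hg', h5⟩
      · intro h5
        by_contra h6
        exact h4.2 h5 ⟨g', hg', h6⟩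
    · refine (hθ e').2.2 he' e ⟨hee, fun g hg => ?_⟩
      rw [MSC.proc_iff] at hee hg
      omega
  · rintro ⟨s, c, d, hc⟩
    refine ⟨fun e => (s e, c e, d e), fun e => ⟨⟨fun he => ?_, fun g hg => ⟨hc.block e g hg,
      hc.up e g hg⟩⟩, fun g hg he => ⟨?_, ?_⟩, fun he g hg => hc.succ g e hg.1 he⟩⟩
    · obtain ⟨g, hg⟩ := hc.exists_of_mem e he
      exact ⟨g, hg, trivial⟩
    · rintro h5 ⟨g', hg', h6⟩
      exact (hc.down e g hg he g' hg').1 h6 h5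
    · rintro h5 ⟨g', hg', h6⟩
      exact h6 ((hc.down e g hg he g' hg').2 h5)

/-- On each process `p`, the relation `≤ · R` restricted to `p` has images that shrink to the right,
so `exists_le` applies; the finitely many processes are then combined. -/
theorem exists_ge_le [Finite P] (h : Navigable R) :
    Transducible fun M (_ : M.Event → Γ) e => ∃ e' f, M.loc e' = M.loc e ∧ M.loc f = M.loc e ∧
      M.pos e ≤ M.pos e' ∧ R M e' f ∧ M.pos f ≤ M.pos e := by
  have ht (p : P) : Navigable fun (M : MSC P A) e f => e = f ∧ M.loc e = p :=
    test (Transducible.pointwise fun p' _ _ => p' = p)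
  have hn (p : P) : Navigable fun (M : MSC P A) e f => M.loc e = p ∧ M.loc f = p ∧
      ∃ e', M.loc e = M.loc e' ∧ M.pos e ≤ M.pos e' ∧ R M e' f := by
    refine (((ht p).comp le).comp (h.comp (ht p))).congr fun M e f => ?_
    constructor
    · rintro ⟨e', ⟨_, ⟨rfl, h1⟩, h2, h3⟩, f, h4, rfl, h5⟩
      exact ⟨h1, h5, e', h2, h3, h4⟩
    · rintro ⟨h1, h5, e', h2, h3, h4⟩
      exact ⟨e', ⟨_, ⟨rfl, h1⟩, h2, h3⟩, f, h4, rfl, h5⟩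
  refine (Transducible.exists_finite fun p => (hn p).exists_le (Γ := Γ) (p := p)
    (fun M e f h => ⟨h.1, h.2.1⟩) fun M e e' f hl hle ⟨h1, h2, k, h3, h4, h5⟩ =>
      ⟨hl.trans h1, h2, k, hl.trans h3, hle.trans h4, h5⟩).congr fun M γ e => propext ?_
  constructor
  · rintro ⟨p, f, ⟨rfl, h2, e', h3, h4, h5⟩, h6⟩
    exact ⟨e', f, h3.symm, h2, h4, h5, h6⟩
  · rintro ⟨e', f, h3, h2, h4, h5, h6⟩
    exact ⟨_, f, ⟨rfl, h2, e', h3.symm, h4, h5⟩, h6⟩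

theorem loop [Finite P] (h : Navigable R) (h' : Navigable fun M e f => R M f e) :
    Transducible fun M (_ : M.Event → Γ) e => R M e e := by
  refine ((h.diamond (.const True)).and ((h'.diamond (.const True)).and
    (h.exists_ge_le.and h'.exists_ge_le))).congr fun M γ e => ?_
  rw [(h.regular M).self_iff e]
  simp only [and_true]

end Navigable

/-! ### Formulas -/

section

variable {P : Type u} {A : Type v} [Finite P]

mutual

theorem EventFormula.transducible {Γ : Type} : (φ : EventFormula P A) →
    Transducible fun M (_ : M.Event → Γ) e => EventFormula.Sat M φ e
  | .atProc p => by
    simp only [EventFormula.Sat]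
    exact .pointwise fun p' _ _ => p' = p
  | .letter a => by
    simp only [EventFormula.Sat]
    exact .pointwise fun _ a' _ => a' = a
  | .or φ ψ => by
    simp only [EventFormula.Sat]
    exact φ.transducible.or ψ.transducible
  | .not φ => by
    simp only [EventFormula.Sat]
    exact φ.transducible.not
  | .diamond π φ => by
    simp only [EventFormula.Sat]
    exact π.navigable.1.diamond φ.transducible
  | .loop π => by
    simp only [EventFormula.Sat]
    exact π.navigable.1.loop π.navigable.2

/-- Converses are carried through the induction because `Navigable.loop` needs both directions. -/
theorem PathFormula.navigable : (π : PathFormula P A) →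
    (Navigable fun M e f => PathFormula.Sat M π e f) ∧
      Navigable fun M e f => PathFormula.Sat M π f e
  | .next => by
    simp only [PathFormula.Sat]
    exact ⟨.next, .prev⟩
  | .prev => by
    simp only [PathFormula.Sat]
    exact ⟨.prev, .next⟩
  | .msg p q _ => by
    simp only [PathFormula.Sat]
    exact ⟨.msg p q, (Navigable.msgInv p q).congr fun M e f => by tauto⟩
  | .msgInv p q _ => by
    simp only [PathFormula.Sat]
    exact ⟨.msgInv p q, (Navigable.msg p q).congr fun M e f => by tauto⟩
  | .until φ => by
    simp only [PathFormula.Sat]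
    exact ⟨.strictUntil φ.transducible, .strictSince φ.transducible⟩
  | .since φ => by
    simp only [PathFormula.Sat]
    exact ⟨.strictSince φ.transducible, .strictUntil φ.transducible⟩
  | .jump p r => by
    simp only [PathFormula.Sat]
    exact ⟨.jump p r, (Navigable.jump r p).congr fun M e f => and_comm⟩
  | .test φ => by
    simp only [PathFormula.Sat]
    refine ⟨.test φ.transducible, (Navigable.test φ.transducible).congr fun M e f => ?_⟩
    constructor <;> exact fun ⟨h1, h2⟩ => ⟨h1.symm, h1 ▸ h2⟩
  | .comp π π' => by
    simp only [PathFormula.Sat]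
    exact ⟨π.navigable.1.comp π'.navigable.1,
      (π'.navigable.2.comp π.navigable.2).congr fun M e f =>
        exists_congr fun g => and_comm⟩

end

end

/-- The output guessed by the tiling is compared with the second component of the letter that is
read. -/
theorem Transducible.exists_transducer {P : Type u} {A : Type v} {Γ : Type} [Finite Γ]
    {F : ∀ M : MSC P A, (M.Event → Unit) → M.Event → Γ} (hF : Transducible F) :
    ∃ T : Transducer P A Γ, Transducer.relation T =
      {x | ∃ M : MSC P A, x = (M, M.relabel (F M fun _ => ()))} := by
  obtain ⟨B, hB, T, hT⟩ := hF
  let k : Γ × B → (Unit × Γ) × B := fun y => (((), y.1), y.2)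
  let T' : Tiling P (A × Γ) (Γ × B) :=
    { node := fun p x y => y.1 = x.2 ∧ T.node p x.1 (k y)
      first := fun p y => T.first p (k y)
      succ := fun p y z => T.succ p (k y) (k z)
      msg := fun p q y z => T.msg p q (k y) (k z)
      internal := fun p y => T.internal p (k y)
      acc := fun s => T.acc fun p => (s p).map k }
  have hT' : ∀ (N : MSC P (A × Γ)) (ℓ : N.Event → Γ × B), T'.Ok N ℓ ↔
      (∀ e, (ℓ e).1 = (N.lab e).2) ∧ T.Ok (N.relabel fun e => (N.lab e).1) fun e => k (ℓ e) := by
    intro N ℓ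
    have hl : (fun p => ((N.last p).map ℓ).map k) =
        fun p => ((N.relabel fun e => (N.lab e).1).last p).map fun e => k (ℓ e) := by
      simp only [Option.map_map]
      rfl
    constructor
    · rintro ⟨h1, h2, h3, h4, h5, h6⟩
      exact ⟨fun e => (h1 e).1, fun e => (h1 e).2, h2, h3, h4, h5, (congrArg T.acc hl).mp h6⟩
    · rintro ⟨h0, h1, h2, h3, h4, h5, h6⟩
      exact ⟨fun e => ⟨h0 e, h1 e⟩, h2, h3, h4, h5, (congrArg T.acc hl).mpr h6⟩
  refine ⟨T'.toCFM, Set.ext fun x => ⟨?_, ?_⟩⟩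
  · rintro ⟨N, hN, rfl⟩
    obtain ⟨ℓ, hℓ⟩ := (T'.mem_language_toCFM N).1 hN
    obtain ⟨h1, h2⟩ := (hT' N ℓ).1 hℓ
    have h3 := (hT (N.relabel fun e => (N.lab e).1) fun e => ((), (ℓ e).1)).2 ⟨_, h2⟩
    refine ⟨N.relabel fun e => (N.lab e).1, Prod.ext rfl ?_⟩
    exact congrArg (fun γ : N.Event → Γ => N.relabel γ) (funext fun e => (h1 e).symm.trans (h3 e))
  · rintro ⟨M, rfl⟩
    obtain ⟨β, hβ⟩ := (hT M fun e => ((), F M (fun _ => ()) e)).1 fun _ => rfl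
    refine ⟨M.relabel fun e => (M.lab e, F M (fun _ => ()) e), ?_, rfl⟩
    exact (T'.mem_language_toCFM _).2
      ⟨fun e => (F M (fun _ => ()) e, β e), (hT' _ _).2 ⟨fun _ => rfl, hβ⟩⟩

theorem mainTheorem5 {P : Type u} {A : Type v} [Finite P] [Nonempty P] [Finite A] [Nonempty A]
    (φ : EventFormula P A) :
    ∃ T : Transducer P A Bool,
      Transducer.relation T = {x | ∃ M : MSC P A, x = (M, M.truth φ)} := by
  classical
  exact Transducible.exists_transducer
    (F := fun M _ e => decide (EventFormula.Sat M φ e)) (φ.transducible.map fun x => decide x)
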